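/- Let $N\ge 1$, $n\ge 0$ be integers with $M=N+n$ even, let $\tau\in(0,1)$, $\eta_+=\frac1{1-\tau^2}$, $\eta_-=\frac{\tau}{1-\tau^2}$, let $\sigma_1,\dots,\sigma_N>\tau$, put $\varrho_k=\frac{\tau}{\sigma_k+\tau}$ for $1\le k\le N$, and let $\varrho_{N+1},\dots,\varrho_M\in(0,\tfrac12)$ be such that $\varrho_1,\dots,\varrho_M$ are pairwise distinct (all of them then lie in $(0,\frac12)$). With $I_0$ the modified Bessel function and $\omega(x,y)=e^{-\frac12(x^2+y^2)}\frac{x-y}{x+y}$, define for $u,v>0$, $1\le j\le N$ and $1\le a,b\le n$ $$\mathcal E(u,v)=\int_{\mathbb R^2}\omega(x,y)\bigl(I_0(2x\sqrt u)I_0(2y\sqrt v)-I_0(2y\sqrt u)I_0(2x\sqrt v)\bigr)\,dx\,dy,$$ $$\epsilon(u,v)=\mathcal E(\eta_-u,\eta_-v),\qquad \phi_j(u)=e^{-(\eta_+\sigma_j+\eta_-)u},$$ $$h_a(u)=\eta_-^{a-1}\int_{\mathbb R^2}\omega(x,y)\bigl(I_0(2y\sqrt{\eta_-u})e^{\varrho_{a+N}x^2}-I_0(2x\sqrt{\eta_-u})e^{\varrho_{a+N}y^2}\bigr)\,dx\,dy,$$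 $$\alpha_{a,b}=\eta_-^{a+b-2}\int_{\mathbb R^2}\omega(x,y)\bigl(e^{\varrho_{b+N}y^2}e^{\varrho_{a+N}x^2}-e^{\varrho_{b+N}x^2}e^{\varrho_{a+N}y^2}\bigr)\,dx\,dy .$$ Put $\epsilon\phi_k(x)=\int_0^\infty\epsilon(x,z)\phi_k(z)\,dz$ for $k\le N$ and $\epsilon\phi_k=h_{k-N}$ for $k>N$. The Gram matrix $G=[g_{jk}]_{j,k=1}^M$ has $g_{jk}=\int_0^\infty\phi_j\,\epsilon\phi_k$ if $j\le N$, $g_{jk}=-\int_0^\infty\epsilon\phi_j\,\phi_k$ if $k\le N<j$, and $g_{jk}=\alpha_{j-N,k-N}$ if $j,k>N$. Then all these integrals converge absolutely and $G$ is invertible. Put $G^{-1}=[c_{jk}]$ and let $$DS_N(u,v)=\sum_{j,k=1}^N\phi_j(u)c_{kj}\phi_k(v),\qquad S_N(u,v)=\sum_{j=1}^N\phi_j(u)\sum_{k=1}^{M}c_{kj}\,\epsilon\phi_k(v),$$ $$IS_N(u,v)=-\epsilon(u,v)+\sum_{j,k=1}^{M}\epsilon\phi_j(u)\,c_{kj}\,\epsilon\phi_k(v)$$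 be the entries of the Pfaffian correlation kernel $\begin{bmatrix}DS_N(u,v)&S_N(u,v)\\-S_N(v,u)&IS_N(u,v)\end{bmatrix}$ of the extended ensemble. For $A,B\subseteq\{1,\dots,M\}$ put $$K_{A,B}(u,v)=\frac{\eta_-^2}{4\pi}\int_{\mathcal C_{A}}\frac{dw}{2\pi i}\int_{\mathcal C'_{B}}\frac{dz}{2\pi i}\;e^{-\frac{\eta_-u}{w}-\frac{\eta_-v}{1-z}}\frac{1}{\sqrt{(2z-1)(1-2w)}}\,\frac{1-z-w}{w-z}\,\frac{1}{(1-z)w}\prod_{k=1}^{M}\frac{z-\varrho_k}{w-\varrho_k}\,\frac{1-w-\varrho_k}{1-z-\varrho_k},$$ where the square root is principal, $\mathcal C_A$ is any contour (one or finitely many closed piecewise $C^1$ curves) in $\{\operatorname{Re}w<\frac12\}$ with winding number $1$ about $\varrho_k$ for $k\in A$ and $0$ about $0$ and about $\varrho_k$ for $k\notin A$, and $\mathcal C'_B$ is any such contour in $\{\operatorname{Re}z>\frac12\}$ with winding number $1$ about $1-\varrho_k$ for $k\in B$ and $0$ about $1$ and about $1-\varrho_k$ for $k\notin B$ (the contours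 pass through none of these points). Write $[N]=\{1,\dots,N\}$, $[M]=\{1,\dots,M\}$. Then for all $u,v>0$ $$DS_N(u,v)=K_{[N],[N]}(u,v),$$ $$S_N(u,v)=\int_0^\infty \mathcal E(\eta_-v,\eta_-t)\,\widetilde{DS}_N(u,t)\,dt,\qquad \widetilde{DS}_N=K_{[N],[M]},$$ $$IS_N(u,v)=-\mathcal E(\eta_-u,\eta_-v)+\int_0^\infty\!\!\int_0^\infty \mathcal E(\eta_-v,\eta_-t)\,\widetilde{\widetilde{DS}}_N(s,t)\,\mathcal E(\eta_-u,\eta_-s)\,ds\,dt,\qquad \widetilde{\widetilde{DS}}_N=K_{[M],[M]},$$ with absolutely convergent integrals. -/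

import Mathlib

namespace PfaffianKernel

noncomputable section

/-! ### Kernels built from a determinant-Pfaffian ensemble -/

/-- The data entering a density proportional to
`det [φ_j(x_k)] * Pf [[ε(x_j, x_k), h_b(x_j)], [-h_a(x_k), α_{a,b}]]` on `Ω^N`.
The index set `{1, …, N + n}` is written as `Fin N ⊕ Fin n`. -/
structure EnsembleData (Ω : Type*) (N n : ℕ) where
  phi : Fin N → Ω → ℝ
  h : Fin n → Ω → ℝ
  eps : Ω → Ω → ℝ
  alpha : Fin n → Fin n → ℝ

namespace EnsembleData

variable {Ω : Type*} [MeasurableSpace Ω] {N n : ℕ}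

/-- `εφ_k(x) = ∫ ε(x, z) φ_k(z) dν(z)` for `k ≤ N`, and `εφ_k = h_{k-N}` for `k > N`. -/
def epsPhi (D : EnsembleData Ω N n) (ν : MeasureTheory.Measure Ω) :
    Fin N ⊕ Fin n → Ω → ℝ
  | Sum.inl k, x => ∫ z, D.eps x z * D.phi k z ∂ν
  | Sum.inr a, x => D.h a x

/-- The Gram matrix `G`. -/
def gram (D : EnsembleData Ω N n) (ν : MeasureTheory.Measure Ω) :
    Matrix (Fin N ⊕ Fin n) (Fin N ⊕ Fin n) ℝ
  | Sum.inl j, k => ∫ x, D.phi j x * D.epsPhi ν k x ∂ν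
  | Sum.inr a, Sum.inl k => -∫ x, D.epsPhi ν (Sum.inr a) x * D.phi k x ∂ν
  | Sum.inr a, Sum.inr b => D.alpha a b

/-- `DS_N(x, y) = ∑_{j,k ≤ N} φ_j(x) c_{kj} φ_k(y)` with `C = G⁻¹`. -/
def DS (D : EnsembleData Ω N n) (ν : MeasureTheory.Measure Ω) (x y : Ω) : ℝ :=
  ∑ j : Fin N, ∑ k : Fin N, D.phi j x * (D.gram ν)⁻¹ (Sum.inl k) (Sum.inl j) * D.phi k y

/-- `S_N(x, y) = ∑_{j ≤ N} φ_j(x) ∑_{k ≤ N+n} c_{kj} εφ_k(y)`. -/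
def S (D : EnsembleData Ω N n) (ν : MeasureTheory.Measure Ω) (x y : Ω) : ℝ :=
  ∑ j : Fin N, D.phi j x *
    ∑ k : Fin N ⊕ Fin n, (D.gram ν)⁻¹ k (Sum.inl j) * D.epsPhi ν k y

/-- `IS_N(x, y) = -ε(x, y) + ∑_{j,k ≤ N+n} εφ_j(x) c_{kj} εφ_k(y)`. -/
def IS (D : EnsembleData Ω N n) (ν : MeasureTheory.Measure Ω) (x y : Ω) : ℝ :=
  -D.eps x y + ∑ j : Fin N ⊕ Fin n, ∑ k : Fin N ⊕ Fin n,
    D.epsPhi ν j x * (D.gram ν)⁻¹ k j * D.epsPhi ν k y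

end EnsembleData

/-! ### The extended ensemble -/

/-- `η₊ = 1 / (1 - τ²)`. -/
def etaPlus (τ : ℝ) : ℝ := 1 / (1 - τ ^ 2)

/-- `η₋ = τ / (1 - τ²)`. -/
def etaMinus (τ : ℝ) : ℝ := τ / (1 - τ ^ 2)

/-- The modified Bessel function `I₀`. -/
def besselI0 (x : ℝ) : ℝ := ∑' k : ℕ, (x / 2) ^ (2 * k) / (k.factorial : ℝ) ^ 2

/-- `exp(-(x² + y²)/2) (x - y)/(x + y)`. -/
def schurWeight (x y : ℝ) : ℝ :=
  Real.exp (-(1 / 2) * (x ^ 2 + y ^ 2)) * ((x - y) / (x + y))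

/-- The integrand of `𝓔(u, v)`. -/
def calEIntegrand (u v : ℝ) (p : ℝ × ℝ) : ℝ :=
  schurWeight p.1 p.2 *
    (besselI0 (2 * p.1 * √u) * besselI0 (2 * p.2 * √v) -
      besselI0 (2 * p.2 * √u) * besselI0 (2 * p.1 * √v))

/-- `𝓔(u, v)`. -/
def calE (u v : ℝ) : ℝ := ∫ p : ℝ × ℝ, calEIntegrand u v p

/-- The parameters `ϱ_1, …, ϱ_{N+n}`: `ϱ_k = τ / (σ_k + τ)` for `k ≤ N`, and the auxiliary
parameters `r_1, …, r_n` for `k > N`. -/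
def varrho {N n : ℕ} (τ : ℝ) (σ : Fin N → ℝ) (r : Fin n → ℝ) : Fin N ⊕ Fin n → ℝ
  | Sum.inl k => τ / (σ k + τ)
  | Sum.inr a => r a

/-- The integrand of `h_a(u)` without its prefactor; `ρ` stands for `ϱ_{a+N}`. -/
def hIntegrand (η ρ u : ℝ) (p : ℝ × ℝ) : ℝ :=
  schurWeight p.1 p.2 *
    (besselI0 (2 * p.2 * √(η * u)) * Real.exp (ρ * p.1 ^ 2) -
      besselI0 (2 * p.1 * √(η * u)) * Real.exp (ρ * p.2 ^ 2))

/-- The integrand of `α_{a,b}` without its prefactor; `ρ, ρ'` stand for `ϱ_{a+N}, ϱ_{b+N}`. -/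
def alphaIntegrand (ρ ρ' : ℝ) (p : ℝ × ℝ) : ℝ :=
  schurWeight p.1 p.2 *
    (Real.exp (ρ' * p.2 ^ 2) * Real.exp (ρ * p.1 ^ 2) -
      Real.exp (ρ' * p.1 ^ 2) * Real.exp (ρ * p.2 ^ 2))

/-- The extended ensemble. The index `a : Fin n` starts at `0`, so the exponents `a - 1` and
`a + b - 2` of the usual numbering become `a` and `a + b`. -/
def extendedEnsemble {N n : ℕ} (τ : ℝ) (σ : Fin N → ℝ) (r : Fin n → ℝ) :
    EnsembleData ℝ N n where
  phi j u := Real.exp (-(etaPlus τ * σ j + etaMinus τ) * u)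
  h a u := etaMinus τ ^ (a : ℕ) * ∫ p : ℝ × ℝ, hIntegrand (etaMinus τ) (r a) u p
  eps u v := calE (etaMinus τ * u) (etaMinus τ * v)
  alpha a b := etaMinus τ ^ ((a : ℕ) + (b : ℕ)) * ∫ p : ℝ × ℝ, alphaIntegrand (r a) (r b) p

/-- Lebesgue measure on `Ω = (0, ∞)`. -/
def halfLine : MeasureTheory.Measure ℝ := MeasureTheory.volume.restrict (Set.Ioi 0)

/-! ### Contours -/

/-- A contour: finitely many closed piecewise `C¹` curves, each parametrised by `[0, 1]`
(a single closed curve is the case `m = 1`). -/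
structure Contour where
  m : ℕ
  curve : Fin m → ℝ → ℂ
  continuousOn : ∀ i, ContinuousOn (curve i) (Set.Icc 0 1)
  closed : ∀ i, curve i 0 = curve i 1
  piecewiseC1 : ∀ i, ∃ P : Finset ℝ,
    (∀ t ∈ Set.Ioo (0 : ℝ) 1 \ ↑P, DifferentiableAt ℝ (curve i) t) ∧
    ContinuousOn (deriv (curve i)) (Set.Ioo 0 1 \ ↑P) ∧
    ∃ B : ℝ, ∀ t ∈ Set.Ioo (0 : ℝ) 1 \ ↑P, ‖deriv (curve i) t‖ ≤ B

namespace Contour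

/-- The set of points lying on the contour. -/
def support (Γ : Contour) : Set ℂ := ⋃ i, Γ.curve i '' Set.Icc 0 1

/-- `∫_Γ f(z) dz / (2πi)`. -/
def integral (Γ : Contour) (f : ℂ → ℂ) : ℂ :=
  (2 * Real.pi * Complex.I)⁻¹ *
    ∑ i, ∫ t in (0 : ℝ)..1, f (Γ.curve i t) * deriv (Γ.curve i) t

/-- The winding number of `Γ` about `a` (meaningful for `a` off the contour). -/
def windingNumber (Γ : Contour) (a : ℂ) : ℂ := Γ.integral fun z => (z - a)⁻¹

/-- `Γ` goes around `a` once, anticlockwise. -/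
def Encircles (Γ : Contour) (a : ℂ) : Prop := a ∉ Γ.support ∧ Γ.windingNumber a = 1

/-- `Γ` does not go around `a`. -/
def Excludes (Γ : Contour) (a : ℂ) : Prop := a ∉ Γ.support ∧ Γ.windingNumber a = 0

end Contour

/-- The contours `𝓒_{ϱ_k : k ∈ A}` for `w`: they lie in `Re w < 1/2`, encircle `ϱ_k` for
`k ∈ A`, and encircle neither the other `ϱ_k` nor the singularity `0`. -/
def IsWContour {ι : Type*} (ϱ : ι → ℝ) (A : Set ι) (Γ : Contour) : Prop :=
  Γ.support ⊆ {w : ℂ | w.re < 1 / 2} ∧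
    (∀ k ∈ A, Γ.Encircles (ϱ k : ℂ)) ∧ (∀ k ∉ A, Γ.Excludes (ϱ k : ℂ)) ∧ Γ.Excludes 0

/-- The contours `𝓒_{1 - ϱ_k : k ∈ A}` for `z`: they lie in `Re z > 1/2`, encircle `1 - ϱ_k`
for `k ∈ A`, and encircle neither the other `1 - ϱ_k` nor the singularity `1`. -/
def IsZContour {ι : Type*} (ϱ : ι → ℝ) (A : Set ι) (Γ : Contour) : Prop :=
  Γ.support ⊆ {z : ℂ | 1 / 2 < z.re} ∧
    (∀ k ∈ A, Γ.Encircles (1 - ϱ k : ℂ)) ∧ (∀ k ∉ A, Γ.Excludes (1 - ϱ k : ℂ)) ∧ Γ.Excludes 1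

/-- The integrand of the double contour integral; `Complex.sqrt` is the principal square root. -/
def contourIntegrand {ι : Type*} [Fintype ι] (η : ℝ) (ϱ : ι → ℝ) (u v : ℝ) (w z : ℂ) : ℂ :=
  Complex.exp (-(η * u / w) - η * v / (1 - z)) *
    (1 / Complex.sqrt ((2 * z - 1) * (1 - 2 * w))) *
    ((1 - z - w) / (w - z)) * (1 / ((1 - z) * w)) *
    ∏ k, ((z - ϱ k) / (w - ϱ k) * ((1 - w - ϱ k) / (1 - z - ϱ k)))

/-- `η² / (4π) ∫_{Γw} dw/(2πi) ∫_{Γz} dz/(2πi) (…)`. -/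
def contourKernel {ι : Type*} [Fintype ι] (η : ℝ) (ϱ : ι → ℝ) (Γw Γz : Contour) (u v : ℝ) : ℂ :=
  (η ^ 2 / (4 * Real.pi) : ℝ) *
    Γw.integral fun w => Γz.integral fun z => contourIntegrand η ϱ u v w z

end

end PfaffianKernel

open PfaffianKernel

/-! The two sides are finite double sums over the indices `j, k`, and the proof matches their
coefficients.

Write ⟨F, G⟩ = ∫ ω(x,y)(F(x)G(y) − F(y)G(x)) and g_ρ(x) = exp(ρx²). The Laplace transform of t ↦
I₀(2x√(ηt)) at η/ρ is (ρ/η) g_ρ(x), and φ_j(t) = exp(−(η/ϱ_j)t) with η = η₋. Integrating a Bessel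
slot against φ_j therefore replaces it by a Gaussian (`GaussGrowth.integral_exp_mul_schurForm`). The
auxiliary h_a and α_{a,b} have Gaussian slots from the start, so all M indices behave alike: εφ_k(u)
= d_k⟨I₀(2·√(ηu)), g_{ϱ_k}⟩ and G_{jk} = d_j⟨g_{ϱ_j}, g_{ϱ_k}⟩d_k with explicit d
(`extendedEnsemble_gram`).

The form on Gaussians is elementary (`schurForm_exp`). With a_k = 1/2 − ϱ_k it equals 2π(a_k −
a_j)/((a_j + a_k)√(a_j a_k)), a diagonal conjugate of the Schur matrix. For M even that matrix has
an explicit inverse, proved by adding the residues of a rational function (`sum_schurMat_mul_self`,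
`sum_schurMat_mul_of_ne`).

On the contour side, after z = 1 − ζ the integrand has simple poles at the ϱ_k in both variables and
essential singularities at 0, which the contours exclude. The double integral is then a double sum
of residues (`contourKernel_eq_sum`), and its coefficients are those of the rescaled inverse
(`residueCoeff_eq`). Enlarging [N] to [M] lets the sums run over all indices. Integration against 𝓔
turns each exponential, also for k > N, into the form occurring in εφ_k, which gives S and IS. -/

namespace PfaffianKernel

/-! ### Explicit inverse of the Schur matrix of even size. -/

section SchurInverse

open Finset Polynomial

variable {ι F : Type*} [Fintype ι] [DecidableEq ι] [Field F]

/-- The Lagrange interpolation identity for `∏ (z + b l) / (z ∏ (z - c l))`. -/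
theorem sum_prod_add_div_prod_sub (b c : ι → F) (hc : Function.Injective c) (hc0 : ∀ k, c k ≠ 0) :
    (∏ l, b l / (-c l)) +
      ∑ k, (c k + b k) / c k * ∏ l ∈ univ.erase k, (c k + b l) / (c k - c l) = 1 := by
  classical
  -- The nodes are 0 and the c_k, one more than the degree of ∏ (X + b_l). The leading coefficient 1
  -- of this monic polynomial is thus the top coefficient of its own interpolant.
  set v : Option ι → F := fun o => o.elim 0 c with hv
  have hinj : Function.Injective v := by
    rintro (_ | x) (_ | y) h
    · rfl
    · exact absurd h.symm (hc0 y)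
    · exact absurd h (hc0 x)
    · exact congrArg some (hc h)
  set P : F[X] := ∏ l, (X - C (-b l)) with hP
  have hmon : P.Monic := monic_prod_X_sub_C _ _
  have hdeg : P.natDegree = Fintype.card ι := by
    rw [hP, natDegree_finsetProd_X_sub_C_eq_card]; rfl
  have hlt : P.degree < #(univ : Finset (Option ι)) := by
    rw [degree_eq_natDegree hmon.ne_zero, hdeg]
    simp only [card_univ, Fintype.card_option]
    exact_mod_cast Nat.lt_succ_self _
  have key := Lagrange.coeff_eq_sum (v := v) (s := univ) (hinj.injOn) hlt
  have h1 : P.coeff (#(univ : Finset (Option ι)) - 1) = 1 := by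
    simp only [card_univ, Fintype.card_option, Nat.add_sub_cancel]
    rw [← hdeg]; exact hmon
  rw [h1, Fintype.sum_option] at key
  rw [key]
  have hnone : (univ : Finset (Option ι)).erase none = univ.map Function.Embedding.some := by
    ext (_ | x) <;> simp
  have hsome : ∀ k, (univ : Finset (Option ι)).erase (some k) =
      insert none ((univ.erase k).map Function.Embedding.some) := by
    intro k
    ext (_ | x) <;> simp
  congr 1
  · rw [hnone, prod_map, hP, eval_prod, prod_div_distrib]
    simp [hv]
  · refine sum_congr rfl fun k _ => ?_
    rw [hsome, prod_insert (by simp), prod_map, hP, eval_prod,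
      ← mul_prod_erase univ _ (mem_univ k), prod_div_distrib, div_mul_div_comm]
    simp [hv]

/-- The matrix `(a_k - a_j) / (a_j + a_k)`. -/
noncomputable def schurMat (a : ι → ℝ) (j k : ι) : ℝ := (a k - a j) / (a j + a k)

/-- The weights `∏_{l ≠ k} (a_k + a_l) / (a_l - a_k)`. -/
noncomputable def schurCoeff (a : ι → ℝ) (k : ι) : ℝ := ∏ l ∈ univ.erase k, (a k + a l) / (a l - a k)

variable {a : ι → ℝ}

theorem schurCoeff_ne_zero (ha : ∀ k, 0 < a k) (hinj : Function.Injective a) (k : ι) :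
    schurCoeff a k ≠ 0 := by
  refine prod_ne_zero_iff.2 fun l hl => div_ne_zero (add_pos (ha k) (ha l)).ne' ?_
  exact sub_ne_zero.2 fun h => (mem_erase.1 hl).1 (hinj h)

/-- There are M − 1 factors, an odd number, and each changes sign. -/
theorem schurCoeff_eq_neg_prod (hM : Even (Fintype.card ι)) (k : ι) :
    schurCoeff a k = -∏ l ∈ univ.erase k, (a k + a l) / (a k - a l) := by
  have h : ∀ l ∈ univ.erase k, (a k + a l) / (a l - a k) = -1 * ((a k + a l) / (a k - a l)) := by
    intro l _
    rw [← neg_sub (a k), div_neg]; ring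
  have hodd : Odd (#((univ : Finset ι).erase k)) := by
    rw [card_erase_of_mem (mem_univ k), card_univ]
    exact Nat.Even.sub_odd (Fintype.card_pos_iff.2 ⟨k⟩) hM odd_one
  rw [schurCoeff, prod_congr rfl h, prod_mul_distrib, prod_const, hodd.neg_one_pow]
  ring

/-- Apply the interpolation identity to the nodes a_k with a_i replaced by −a_i, in numerator and
denominator alike. The residue at −a_i yields the inverse weight, the other residues yield the terms
k ≠ i, and the residue at 0 is (−1)^M = 1, which cancels the right-hand side. -/
theorem sum_schurMat_mul_self (hM : Even (Fintype.card ι)) (ha : ∀ k, 0 < a k)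
    (hinj : Function.Injective a) (i : ι) :
    ∑ k, schurMat a i k * schurCoeff a k * schurMat a k i = (schurCoeff a i)⁻¹ := by
  have ha0 : ∀ k, a k ≠ 0 := fun k => (ha k).ne'
  have hs : ∀ k l, a k + a l ≠ 0 := fun k l => (add_pos (ha k) (ha l)).ne'
  have hd : ∀ k l, k ≠ l → a k - a l ≠ 0 := fun k l h => sub_ne_zero.2 fun h' => h (hinj h')
  set b : ι → ℝ := fun k => if k = i then -a i else a k with hb
  have hcinj : Function.Injective b := by
    intro x y h
    by_cases hx : x = i <;> by_cases hy : y = i <;> simp only [hb, hx, hy, if_true, if_false] at h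
    · rw [hx, hy]
    · exact absurd h (by linarith [ha i, ha y] : -a i < a y).ne
    · exact absurd h (by linarith [ha i, ha x] : -a i < a x).ne'
    · exact hinj h
  have hc0 : ∀ k, b k ≠ 0 := by
    intro k
    by_cases hx : k = i <;> simp [hb, hx, ha0]
  have key := sum_prod_add_div_prod_sub b b hcinj hc0
  have h0 : ∏ l, b l / (-b l) = 1 := by
    have : ∀ l ∈ univ, b l / (-b l) = -1 := by
      intro l _
      rw [div_neg, div_self (hc0 l)]
    rw [prod_congr rfl this, prod_const, card_univ, hM.neg_one_pow]
  rw [h0, add_eq_left, ← add_sum_erase _ _ (mem_univ i)] at key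
  have hi : (b i + b i) / b i * ∏ l ∈ univ.erase i, (b i + b l) / (b i - b l) =
      -2 * (schurCoeff a i)⁻¹ := by
    have : ∏ l ∈ univ.erase i, (b i + b l) / (b i - b l) = -(schurCoeff a i)⁻¹ := by
      rw [schurCoeff_eq_neg_prod hM, inv_neg, neg_neg, ← prod_inv_distrib]
      refine prod_congr rfl fun l hl => ?_
      have hl := (mem_erase.1 hl).1
      simp only [hb, hl, if_true, if_false, inv_div]
      rw [← neg_div_neg_eq]; ring
    rw [this]
    simp only [hb, if_true]
    field_simp [ha0 i]
    ring
  have hk : ∀ k ∈ univ.erase i, (b k + b k) / b k * ∏ l ∈ univ.erase k, (b k + b l) / (b k - b l) =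
      2 * (schurMat a i k * schurCoeff a k * schurMat a k i) := by
    intro k hk
    have hki := (mem_erase.1 hk).1
    have hik : i ∈ univ.erase k := mem_erase.2 ⟨hki.symm, mem_univ i⟩
    rw [schurCoeff_eq_neg_prod hM, ← mul_prod_erase _ _ hik, ← mul_prod_erase _ _ hik]
    have : ∏ l ∈ (univ.erase k).erase i, (b k + b l) / (b k - b l) =
        ∏ l ∈ (univ.erase k).erase i, (a k + a l) / (a k - a l) := by
      refine prod_congr rfl fun l hl => ?_
      have hl := (mem_erase.1 hl).1
      simp only [hb, hl, hki, if_false]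
    rw [this]
    simp only [hb, hki, if_true, if_false, schurMat]
    have h1 := hs k i
    have h2 := hs i k
    have h3 := hd k i hki
    have h4 := ha0 k
    have h5 : a k - -a i ≠ 0 := by rwa [sub_neg_eq_add]
    field_simp
    ring
  rw [hi, sum_congr rfl hk, ← mul_sum] at key
  have h1 := add_sum_erase univ (fun k => schurMat a i k * schurCoeff a k * schurMat a k i)
    (mem_univ i)
  rw [← h1]
  simp only [schurMat, sub_self, zero_div, mul_zero, zero_add] at key ⊢
  linarith

/-- Here the poles stay at the a_k and only the numerator changes sign at i and j. The residues at
a_i and a_j then vanish, just as the diagonal entries of `schurMat` do, and evenness of M again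
makes the residue at 0 equal to 1. -/
theorem sum_schurMat_mul_of_ne (hM : Even (Fintype.card ι)) (ha : ∀ k, 0 < a k)
    (hinj : Function.Injective a) {i j : ι} (hij : i ≠ j) :
    ∑ k, schurMat a i k * schurCoeff a k * schurMat a k j = 0 := by
  have ha0 : ∀ k, a k ≠ 0 := fun k => (ha k).ne'
  have hs : ∀ k l, a k + a l ≠ 0 := fun k l => (add_pos (ha k) (ha l)).ne'
  set b : ι → ℝ := fun k => if k = i ∨ k = j then -a k else a k with hb
  have key := sum_prod_add_div_prod_sub b a hinj ha0
  have hji : j ∈ univ.erase i := mem_erase.2 ⟨hij.symm, mem_univ j⟩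
  have hb' : ∀ l ∈ (univ.erase i).erase j, b l = a l := by
    intro l hl
    have h1 := (mem_erase.1 hl).1
    have h2 := (mem_erase.1 (mem_erase.1 hl).2).1
    simp [hb, h1, h2]
  have hbi : b i = -a i := by simp [hb]
  have hbj : b j = -a j := by simp [hb]
  have h0 : ∏ l, b l / (-a l) = 1 := by
    have : ∀ l ∈ (univ.erase i).erase j, b l / (-a l) = -1 := by
      intro l hl
      rw [hb' l hl, div_neg, div_self (ha0 l)]
    have hcard : Even #(((univ : Finset ι).erase i).erase j) := by
      rw [card_erase_of_mem hji, card_erase_of_mem (mem_univ i), card_univ, Nat.sub_sub]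
      have : 1 < Fintype.card ι := Fintype.one_lt_card_iff.2 ⟨i, j, hij⟩
      exact (Nat.even_sub this).2 (by simp [hM])
    rw [← mul_prod_erase univ _ (mem_univ i), ← mul_prod_erase _ _ hji, prod_congr rfl this,
      prod_const, hcard.neg_one_pow, hbi, hbj, neg_div_neg_eq, neg_div_neg_eq, div_self (ha0 i),
      div_self (ha0 j)]
    norm_num
  rw [h0, add_eq_left] at key
  have hk : ∀ k ∈ univ, (a k + b k) / a k * ∏ l ∈ univ.erase k, (a k + b l) / (a k - a l) =
      2 * (schurMat a i k * schurCoeff a k * schurMat a k j) := by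
    intro k _
    by_cases hki : k = i
    · subst hki; simp [hbi, schurMat]
    by_cases hkj : k = j
    · subst hkj; simp [hbj, schurMat]
    have hik : i ∈ univ.erase k := mem_erase.2 ⟨Ne.symm hki, mem_univ i⟩
    have hjk : j ∈ (univ.erase k).erase i :=
      mem_erase.2 ⟨hij.symm, mem_erase.2 ⟨Ne.symm hkj, mem_univ j⟩⟩
    rw [schurCoeff_eq_neg_prod hM, ← mul_prod_erase _ _ hik, ← mul_prod_erase _ _ hik,
      ← mul_prod_erase _ _ hjk, ← mul_prod_erase _ _ hjk]
    have : ∏ l ∈ ((univ.erase k).erase i).erase j, (a k + b l) / (a k - a l) =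
        ∏ l ∈ ((univ.erase k).erase i).erase j, (a k + a l) / (a k - a l) := by
      refine prod_congr rfl fun l hl => ?_
      have h1 := (mem_erase.1 hl).1
      have h2 := (mem_erase.1 (mem_erase.1 hl).2).1
      simp [hb, h1, h2]
    have hbk : b k = a k := by simp [hb, hki, hkj]
    rw [this, hbi, hbj, hbk]
    simp only [schurMat]
    have h1 := hs k i
    have h2 := hs i k
    have h3 : a k - a i ≠ 0 := sub_ne_zero.2 fun h => hki (hinj h)
    have h4 := ha0 k
    have h5 : a k - a j ≠ 0 := sub_ne_zero.2 fun h => hkj (hinj h)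
    have h6 := hs k j
    field_simp
    ring
  rw [sum_congr rfl hk, ← mul_sum] at key
  linarith

end SchurInverse

open MeasureTheory Set

/-! ### The bilinear form of the Schur weight -/

/-- The integrand of `schurForm`. -/
noncomputable def schurIntegrand (F G : ℝ → ℝ) (p : ℝ × ℝ) : ℝ :=
  schurWeight p.1 p.2 * (F p.1 * G p.2 - F p.2 * G p.1)

/-- The skew-symmetric form `∫ ω(x, y) (F(x) G(y) - F(y) G(x)) dx dy`. -/
noncomputable def schurForm (F G : ℝ → ℝ) : ℝ := ∫ p : ℝ × ℝ, schurIntegrand F G p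

theorem schurForm_swap (F G : ℝ → ℝ) : schurForm G F = -schurForm F G := by
  rw [schurForm, schurForm, ← integral_neg]
  congr 1; ext p; simp only [schurIntegrand]; ring

theorem schurForm_const_mul_right (F G : ℝ → ℝ) (c : ℝ) :
    schurForm F (fun x => c * G x) = c * schurForm F G := by
  rw [schurForm, schurForm, ← integral_const_mul]
  congr 1; ext p; simp only [schurIntegrand]; ring

/-- Gaussian growth of `F` and of its derivative with respect to `x²`. -/
structure GaussGrowth (c C : ℝ) (F : ℝ → ℝ) : Prop where
  bound : ∀ x, |F x| ≤ C * Real.exp (c * x ^ 2)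
  lip : ∀ x y, y ^ 2 ≤ x ^ 2 → |F x - F y| ≤ C * (x ^ 2 - y ^ 2) * Real.exp (c * x ^ 2)

/-- The function dominating `schurIntegrand`. -/
noncomputable def schurMajorant (c c' : ℝ) (p : ℝ × ℝ) : ℝ :=
  (p.1 - p.2) ^ 2 * (Real.exp (-(1 / 2 - c) * p.1 ^ 2) * Real.exp (-(1 / 2 - c') * p.2 ^ 2) +
    Real.exp (-(1 / 2 - c') * p.1 ^ 2) * Real.exp (-(1 / 2 - c) * p.2 ^ 2))

theorem GaussGrowth.nonneg {c C : ℝ} {F : ℝ → ℝ} (hF : GaussGrowth c C F) : 0 ≤ C := by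
  have := (abs_nonneg _).trans (hF.bound 0)
  simpa using this

theorem GaussGrowth.abs_sub_le_of_le {c c' C C' : ℝ} {F G : ℝ → ℝ} (hF : GaussGrowth c C F)
    (hG : GaussGrowth c' C' G) {x y : ℝ} (h : y ^ 2 ≤ x ^ 2) :
    |F x * G y - F y * G x| ≤ C * C' * ((x ^ 2 - y ^ 2) *
      (Real.exp (c * x ^ 2) * Real.exp (c' * y ^ 2) +
        Real.exp (c' * x ^ 2) * Real.exp (c * y ^ 2))) := by
  have h1 : F x * G y - F y * G x = (F x - F y) * G y - F y * (G x - G y) := by ring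
  have h2 := mul_le_mul (hF.lip x y h) (hG.bound y) (abs_nonneg _)
    ((abs_nonneg _).trans (hF.lip x y h))
  have h3 := mul_le_mul (hF.bound y) (hG.lip x y h) (abs_nonneg _)
    ((abs_nonneg _).trans (hF.bound y))
  calc |F x * G y - F y * G x| ≤ |F x - F y| * |G y| + |F y| * |G x - G y| := by
        rw [h1, ← abs_mul, ← abs_mul]; exact abs_sub _ _
    _ ≤ _ := add_le_add h2 h3
    _ = _ := by ring

theorem GaussGrowth.abs_sub_le {c c' C C' : ℝ} {F G : ℝ → ℝ} (hF : GaussGrowth c C F)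
    (hG : GaussGrowth c' C' G) (x y : ℝ) :
    |F x * G y - F y * G x| ≤ C * C' * (|x ^ 2 - y ^ 2| *
      (Real.exp (c * x ^ 2) * Real.exp (c' * y ^ 2) +
        Real.exp (c' * x ^ 2) * Real.exp (c * y ^ 2))) := by
  rcases le_total (y ^ 2) (x ^ 2) with h | h
  · rw [abs_of_nonneg (sub_nonneg.2 h)]
    exact hF.abs_sub_le_of_le hG h
  · rw [abs_sub_comm, abs_sub_comm (x ^ 2), abs_of_nonneg (sub_nonneg.2 h)]
    refine (hF.abs_sub_le_of_le hG h).trans (le_of_eq ?_)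
    ring

/-- The weight has a pole on x + y = 0, but `GaussGrowth.lip` makes F and G Lipschitz in x² up to a
Gaussian factor. The antisymmetrised product thus carries a factor |x² − y²| that cancels x + y. -/
theorem GaussGrowth.abs_schurIntegrand_le {c c' C C' : ℝ} {F G : ℝ → ℝ} (hF : GaussGrowth c C F)
    (hG : GaussGrowth c' C' G) (p : ℝ × ℝ) :
    |schurIntegrand F G p| ≤ C * C' * schurMajorant c c' p := by
  obtain ⟨x, y⟩ := p
  have hC := mul_nonneg hF.nonneg hG.nonneg
  have hw : |(x - y) / (x + y)| * |x ^ 2 - y ^ 2| ≤ (x - y) ^ 2 := by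
    rw [← abs_mul]
    -- On the diagonal x + y = 0 the quotient is 0 by the convention for division.
    by_cases h : x + y = 0
    · rw [h]; simp; positivity
    · rw [show (x - y) / (x + y) * (x ^ 2 - y ^ 2) = (x - y) ^ 2 by field_simp; ring]
      rw [abs_of_nonneg (sq_nonneg _)]
  have h1 := hF.abs_sub_le hG x y
  have hE : ∀ a b : ℝ, Real.exp (-(1 / 2) * (x ^ 2 + y ^ 2)) *
      (Real.exp (a * x ^ 2) * Real.exp (b * y ^ 2)) =
      Real.exp (-(1 / 2 - a) * x ^ 2) * Real.exp (-(1 / 2 - b) * y ^ 2) := by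
    intro a b
    rw [← Real.exp_add, ← Real.exp_add, ← Real.exp_add]; ring_nf
  simp only [schurIntegrand, schurMajorant, schurWeight, abs_mul, Real.abs_exp]
  rw [← hE, ← hE, ← mul_add]
  set A := Real.exp (c * x ^ 2) * Real.exp (c' * y ^ 2) +
    Real.exp (c' * x ^ 2) * Real.exp (c * y ^ 2) with hA
  have hA0 : 0 ≤ A := by positivity
  calc _ ≤ Real.exp (-(1 / 2) * (x ^ 2 + y ^ 2)) * |(x - y) / (x + y)| *
        (C * C' * (|x ^ 2 - y ^ 2| * A)) := by gcongr
    _ = (C * C') * Real.exp (-(1 / 2) * (x ^ 2 + y ^ 2)) * A *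
        (|(x - y) / (x + y)| * |x ^ 2 - y ^ 2|) := by ring
    _ ≤ (C * C') * Real.exp (-(1 / 2) * (x ^ 2 + y ^ 2)) * A * (x - y) ^ 2 := by gcongr
    _ = _ := by ring

theorem integrable_pow_mul_exp_neg_mul_sq {b : ℝ} (hb : 0 < b) (n : ℕ) :
    Integrable fun x : ℝ => x ^ n * Real.exp (-b * x ^ 2) := by
  have := integrable_rpow_mul_exp_neg_mul_sq hb (s := n)
    (lt_of_lt_of_le (by norm_num) (Nat.cast_nonneg n))
  simpa only [Real.rpow_natCast] using this

theorem integrable_schurMajorant {c c' : ℝ} (hc : c < 1 / 2) (hc' : c' < 1 / 2) :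
    Integrable (schurMajorant c c') := by
  have key : ∀ a b : ℝ, 0 < a → 0 < b → Integrable fun p : ℝ × ℝ =>
      (p.1 - p.2) ^ 2 * (Real.exp (-a * p.1 ^ 2) * Real.exp (-b * p.2 ^ 2)) := by
    intro a b ha hb
    have h20 := (integrable_pow_mul_exp_neg_mul_sq ha 2).mul_prod
      (integrable_pow_mul_exp_neg_mul_sq hb 0)
    have h11 := (integrable_pow_mul_exp_neg_mul_sq ha 1).mul_prod
      (integrable_pow_mul_exp_neg_mul_sq hb 1)
    have h02 := (integrable_pow_mul_exp_neg_mul_sq ha 0).mul_prod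
      (integrable_pow_mul_exp_neg_mul_sq hb 2)
    refine ((h20.sub (h11.const_mul 2)).add h02).congr (ae_of_all _ fun p => ?_)
    simp only [Pi.add_apply, Pi.sub_apply]
    ring
  refine ((key _ _ (sub_pos.2 hc) (sub_pos.2 hc')).add
    (key _ _ (sub_pos.2 hc') (sub_pos.2 hc))).congr (ae_of_all _ fun p => ?_)
  simp only [Pi.add_apply, schurMajorant]
  ring

theorem measurable_schurWeight : Measurable fun p : ℝ × ℝ => schurWeight p.1 p.2 := by
  unfold schurWeight
  fun_prop

theorem measurable_schurIntegrand {F G : ℝ → ℝ} (hF : Measurable F) (hG : Measurable G) :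
    Measurable (schurIntegrand F G) := by
  unfold schurIntegrand
  have := measurable_schurWeight
  fun_prop

theorem GaussGrowth.integrable {c c' C C' : ℝ} {F G : ℝ → ℝ} (hF : GaussGrowth c C F)
    (hG : GaussGrowth c' C' G) (hc : c < 1 / 2) (hc' : c' < 1 / 2) (hFm : Measurable F)
    (hGm : Measurable G) : Integrable (schurIntegrand F G) :=
  ((integrable_schurMajorant hc hc').const_mul (C * C')).mono'
    (measurable_schurIntegrand hFm hGm).aestronglyMeasurable
    (ae_of_all _ fun p => hF.abs_schurIntegrand_le hG p)

instance : SFinite halfLine := by unfold halfLine; infer_instance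

/-- Fubini's theorem for `∫ φ(t) ⟨F, G_t⟩ dt`. -/
theorem GaussGrowth.integral_mul_schurForm {c c' C : ℝ} {C' : ℝ → ℝ} {F : ℝ → ℝ}
    {G : ℝ → ℝ → ℝ} {φ : ℝ → ℝ} (hF : GaussGrowth c C F) (hG : ∀ t, 0 < t → GaussGrowth c' (C' t) (G t))
    (hc : c < 1 / 2) (hc' : c' < 1 / 2) (hFm : Measurable F) (hGm : Measurable (Function.uncurry G))
    (hφ : Measurable φ) (hφ' : Integrable (fun t => |φ t| * C' t) halfLine) :
    Integrable (fun t => φ t * schurForm F (G t)) halfLine ∧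
      ∫ t, φ t * schurForm F (G t) ∂halfLine =
        schurForm F fun x => ∫ t, φ t * G t x ∂halfLine := by
  have hpos : ∀ᵐ t ∂halfLine, 0 < t := ae_restrict_mem measurableSet_Ioi
  have hmeas : Measurable fun q : ℝ × (ℝ × ℝ) => φ q.1 * schurIntegrand F (G q.1) q.2 := by
    unfold schurIntegrand
    have h1 : Measurable fun q : ℝ × (ℝ × ℝ) => schurWeight q.2.1 q.2.2 :=
      measurable_schurWeight.comp measurable_snd
    have h2 : Measurable fun q : ℝ × (ℝ × ℝ) => G q.1 q.2.1 :=
      hGm.comp (measurable_fst.prodMk measurable_snd.fst)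
    have h3 : Measurable fun q : ℝ × (ℝ × ℝ) => G q.1 q.2.2 :=
      hGm.comp (measurable_fst.prodMk measurable_snd.snd)
    fun_prop
  have hint : Integrable (fun q : ℝ × (ℝ × ℝ) => φ q.1 * schurIntegrand F (G q.1) q.2)
      (halfLine.prod volume) := by
    -- The Gaussian exponent `c'` does not depend on t, so the majorant is a product of a function
    -- of t and a function of (x, y).
    refine ((hφ'.mul_prod (integrable_schurMajorant hc hc')).const_mul C).mono'
      hmeas.aestronglyMeasurable ?_
    have : ∀ᵐ q ∂(halfLine.prod (volume : Measure (ℝ × ℝ))), 0 < q.1 :=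
      Measure.quasiMeasurePreserving_fst.ae hpos
    filter_upwards [this] with q hq
    rw [Real.norm_eq_abs, abs_mul]
    have := mul_le_mul_of_nonneg_left (hF.abs_schurIntegrand_le (hG _ hq) q.2) (abs_nonneg (φ q.1))
    refine this.trans (le_of_eq ?_)
    ring
  have heq : ∀ t, ∫ p, φ t * schurIntegrand F (G t) p = φ t * schurForm F (G t) := fun t => by
    rw [integral_const_mul, schurForm]
  refine ⟨hint.integral_prod_left.congr (ae_of_all _ heq), ?_⟩
  have hGi : ∀ x, Integrable (fun t => φ t * G t x) halfLine := by
    intro x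
    refine (hφ'.mul_const (Real.exp (c' * x ^ 2))).mono' ?_ ?_
    · have : Measurable fun t => G t x := hGm.comp (measurable_id.prodMk measurable_const)
      exact (hφ.mul this).aestronglyMeasurable
    · filter_upwards [hpos] with t ht
      rw [Real.norm_eq_abs, abs_mul, mul_assoc]
      exact mul_le_mul_of_nonneg_left ((hG t ht).bound x) (abs_nonneg _)
  have hswap := integral_integral_swap (f := fun t p => φ t * schurIntegrand F (G t) p) hint
  rw [← integral_congr_ae (ae_of_all _ heq), hswap, schurForm]
  congr 1; ext p
  have : ∀ t, φ t * schurIntegrand F (G t) p =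
      schurWeight p.1 p.2 * F p.1 * (φ t * G t p.2) -
        schurWeight p.1 p.2 * F p.2 * (φ t * G t p.1) := fun t => by
    simp only [schurIntegrand]; ring
  simp_rw [this]
  rw [integral_sub ((hGi _).const_mul _) ((hGi _).const_mul _), integral_const_mul,
    integral_const_mul, schurIntegrand]
  ring

/-! ### Growth of Gaussians and of the Bessel function -/

theorem measurable_exp_mul_sq (ρ : ℝ) : Measurable fun x : ℝ => Real.exp (ρ * x ^ 2) := by
  fun_prop

theorem gaussGrowth_exp {ρ : ℝ} (h0 : 0 ≤ ρ) (h1 : ρ ≤ 1) :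
    GaussGrowth ρ 1 fun x => Real.exp (ρ * x ^ 2) where
  bound x := by simp
  lip x y h := by
    have hle : Real.exp (ρ * y ^ 2) ≤ Real.exp (ρ * x ^ 2) := by gcongr
    rw [abs_of_nonneg (sub_nonneg.2 hle)]
    have h2 : Real.exp (ρ * y ^ 2) = Real.exp (ρ * x ^ 2) * Real.exp (-(ρ * (x ^ 2 - y ^ 2))) := by
      rw [← Real.exp_add]; ring_nf
    have h3 := Real.add_one_le_exp (-(ρ * (x ^ 2 - y ^ 2)))
    have h4 : ρ * (x ^ 2 - y ^ 2) ≤ 1 * (x ^ 2 - y ^ 2) := by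
      have := sub_nonneg.2 h
      gcongr
    rw [h2]
    have h5 := mul_le_mul_of_nonneg_left (h3.trans' (by linarith : 1 - 1 * (x ^ 2 - y ^ 2) ≤ _))
      (Real.exp_pos (ρ * x ^ 2)).le
    linarith

/-- `∑ X^k / k!²`. -/
noncomputable def besselSeries (X : ℝ) : ℝ := ∑' k : ℕ, X ^ k / (k.factorial : ℝ) ^ 2

theorem besselI0_two_mul_sqrt {s : ℝ} (hs : 0 ≤ s) (x : ℝ) :
    besselI0 (2 * x * √s) = besselSeries (s * x ^ 2) := by
  unfold besselI0 besselSeries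
  congr 1; ext k
  rw [pow_mul]
  congr 2
  rw [show 2 * x * √s / 2 = x * √s by ring, mul_pow, Real.sq_sqrt hs, mul_comm]

/-- One of the two factorials is spent on exp(cX), the other is kept for a series summing to
exp(s/c). Since c > 0 is free, I₀ grows more slowly than every Gaussian, at the price exp(s/c). -/
theorem bessel_term_le {X s c : ℝ} (hX : 0 ≤ X) (hs : 0 ≤ s) (hc : 0 < c) (k : ℕ) :
    (s * X) ^ k / (k.factorial : ℝ) ^ 2 ≤ Real.exp (c * X) * ((s / c) ^ k / k.factorial) := by
  have h := Real.pow_div_factorial_le_exp (c * X) (by positivity) k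
  calc (s * X) ^ k / (k.factorial : ℝ) ^ 2 =
      (c * X) ^ k / k.factorial * ((s / c) ^ k / k.factorial) := by
        rw [div_mul_div_comm, ← mul_pow, ← sq]
        congr 2
        field_simp
    _ ≤ _ := by gcongr

theorem summable_bessel_majorant (X s c : ℝ) :
    Summable fun k : ℕ => Real.exp (c * X) * ((s / c) ^ k / k.factorial) :=
  (Real.summable_pow_div_factorial _).mul_left _

theorem tsum_bessel_majorant (X s c : ℝ) :
    ∑' k : ℕ, Real.exp (c * X) * ((s / c) ^ k / k.factorial) =
      Real.exp (c * X) * Real.exp (s / c) := by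
  rw [tsum_mul_left, Real.exp_eq_exp_ℝ, NormedSpace.exp_eq_tsum_div]

theorem summable_bessel (X : ℝ) : Summable fun k : ℕ => X ^ k / (k.factorial : ℝ) ^ 2 := by
  refine Summable.of_norm_bounded (summable_bessel_majorant |X| 1 1) fun k => ?_
  rw [norm_div, norm_pow, Real.norm_eq_abs, norm_pow, Real.norm_natCast]
  simpa using bessel_term_le (abs_nonneg X) zero_le_one one_pos k

theorem measurable_besselSeries : Measurable besselSeries := by
  refine measurable_of_tendsto_metrizable (f := fun n X => ∑ k ∈ Finset.range n,
    X ^ k / (k.factorial : ℝ) ^ 2) (fun n => by fun_prop) ?_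
  rw [tendsto_pi_nhds]
  exact fun X => (summable_bessel X).hasSum.tendsto_sum_nat

theorem pow_succ_sub_pow_succ_le {X Y : ℝ} (hY : 0 ≤ Y) (h : Y ≤ X) (k : ℕ) :
    X ^ (k + 1) - Y ^ (k + 1) ≤ (X - Y) * ((k + 1) * X ^ k) := by
  rw [← Commute.mul_geom_sum₂ (Commute.all X Y)]
  refine mul_le_mul_of_nonneg_left ?_ (sub_nonneg.2 h)
  calc ∑ i ∈ Finset.range (k + 1), X ^ i * Y ^ (k + 1 - 1 - i) ≤
      ∑ i ∈ Finset.range (k + 1), X ^ k := by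
        refine Finset.sum_le_sum fun i hi => ?_
        have hi := Nat.lt_succ_iff.1 (Finset.mem_range.1 hi)
        have hX := hY.trans h
        calc X ^ i * Y ^ (k - i) ≤ X ^ i * X ^ (k - i) := by gcongr
          _ = X ^ k := by rw [← pow_add, Nat.add_sub_cancel' hi]
    _ = _ := by simp

theorem gaussGrowth_besselSeries {s c : ℝ} (hs : 0 ≤ s) (hc : 0 < c) :
    GaussGrowth c ((1 + s) * Real.exp (s / c)) fun x => besselSeries (s * x ^ 2) where
  bound x := by
    have h0 : 0 ≤ besselSeries (s * x ^ 2) := tsum_nonneg fun k => by positivity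
    rw [abs_of_nonneg h0]
    have h1 : besselSeries (s * x ^ 2) ≤ Real.exp (c * x ^ 2) * Real.exp (s / c) := by
      rw [← tsum_bessel_majorant]
      exact (summable_bessel _).tsum_le_tsum (fun k => bessel_term_le (sq_nonneg x) hs hc k)
        (summable_bessel_majorant _ _ _)
    refine h1.trans ?_
    have : 0 ≤ s * (Real.exp (c * x ^ 2) * Real.exp (s / c)) := by positivity
    linarith
  lip x y h := by
    have hle : ∀ k : ℕ, (s * y ^ 2) ^ k / (k.factorial : ℝ) ^ 2 ≤
        (s * x ^ 2) ^ k / (k.factorial : ℝ) ^ 2 := fun k => by gcongr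
    have hd : 0 ≤ besselSeries (s * x ^ 2) - besselSeries (s * y ^ 2) :=
      sub_nonneg.2 ((summable_bessel _).tsum_le_tsum hle (summable_bessel _))
    rw [abs_of_nonneg hd]
    have hsub : Summable fun k : ℕ => (s * x ^ 2) ^ k / (k.factorial : ℝ) ^ 2 -
        (s * y ^ 2) ^ k / (k.factorial : ℝ) ^ 2 := (summable_bessel _).sub (summable_bessel _)
    -- The constant terms cancel, so the index is shifted by one. The factor k + 1 from the
    -- difference of powers is absorbed by (k + 1)!², and the remaining 1/(k + 1) is bounded by 1.
    have hterm : ∀ k : ℕ, (s * x ^ 2) ^ (k + 1) / ((k + 1).factorial : ℝ) ^ 2 -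
        (s * y ^ 2) ^ (k + 1) / ((k + 1).factorial : ℝ) ^ 2 ≤
        s * (x ^ 2 - y ^ 2) * (Real.exp (c * x ^ 2) * ((s / c) ^ k / k.factorial)) := by
      intro k
      have h1 := pow_succ_sub_pow_succ_le (sq_nonneg y) h k
      have h2 := bessel_term_le (sq_nonneg x) hs hc k
      have h3 : ((k + 1 : ℕ).factorial : ℝ) = (k + 1) * k.factorial := by
        rw [Nat.factorial_succ]; push_cast; ring
      have hk : (1 : ℝ) ≤ k + 1 := by linarith [(Nat.cast_nonneg k : (0 : ℝ) ≤ k)]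
      calc _ = s ^ (k + 1) / ((k + 1) * k.factorial : ℝ) ^ 2 *
            ((x ^ 2) ^ (k + 1) - (y ^ 2) ^ (k + 1)) := by rw [h3]; ring
        _ ≤ s ^ (k + 1) / ((k + 1) * k.factorial : ℝ) ^ 2 *
            ((x ^ 2 - y ^ 2) * ((k + 1) * (x ^ 2) ^ k)) := by gcongr
        _ = s * (x ^ 2 - y ^ 2) * ((s * x ^ 2) ^ k / (k.factorial : ℝ) ^ 2) * (1 / (k + 1)) := by
            rw [mul_pow]
            field_simp
            ring
        _ ≤ s * (x ^ 2 - y ^ 2) * ((s * x ^ 2) ^ k / (k.factorial : ℝ) ^ 2) * 1 := by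
            have := sub_nonneg.2 h
            have h4 : 1 / ((k : ℝ) + 1) ≤ 1 := (div_le_one (by positivity)).2 hk
            gcongr
        _ ≤ _ := by
            have := sub_nonneg.2 h
            rw [mul_one]; gcongr
    have hsum : besselSeries (s * x ^ 2) - besselSeries (s * y ^ 2) ≤
        s * (x ^ 2 - y ^ 2) * (Real.exp (c * x ^ 2) * Real.exp (s / c)) := by
      rw [besselSeries, besselSeries, ← (summable_bessel _).tsum_sub (summable_bessel _),
        hsub.tsum_eq_zero_add, ← tsum_bessel_majorant, ← tsum_mul_left]
      simp only [pow_zero, sub_self, zero_add]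
      exact ((summable_nat_add_iff 1).2 hsub).tsum_le_tsum hterm
        ((summable_bessel_majorant _ _ _).mul_left _)
    refine hsum.trans ?_
    have : 0 ≤ (x ^ 2 - y ^ 2) * (Real.exp (c * x ^ 2) * Real.exp (s / c)) :=
      mul_nonneg (sub_nonneg.2 h) (by positivity)
    linarith

theorem integrableOn_pow_mul_exp_neg_mul {b : ℝ} (hb : 0 < b) (k : ℕ) :
    Integrable (fun t : ℝ => t ^ k * Real.exp (-b * t)) halfLine := by
  have := integrableOn_rpow_mul_exp_neg_mul_rpow (p := 1) (s := k) (b := b)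
    (lt_of_lt_of_le (by norm_num) (Nat.cast_nonneg k)) one_pos hb
  simp only [Real.rpow_natCast, Real.rpow_one] at this
  exact this

theorem integral_pow_mul_exp_neg_mul {b : ℝ} (hb : 0 < b) (k : ℕ) :
    ∫ t : ℝ, t ^ k * Real.exp (-b * t) ∂halfLine = k.factorial / b ^ (k + 1) := by
  have := Real.integral_rpow_mul_exp_neg_mul_Ioi (a := k + 1) (r := b) (by positivity) hb
  rw [Real.Gamma_nat_eq_factorial, add_sub_cancel_right] at this
  simp only [Real.rpow_natCast] at this
  rw [halfLine]
  simp_rw [neg_mul]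
  rw [this, ← Nat.cast_succ, Real.rpow_natCast, div_pow, one_pow]
  field_simp

/-- The Laplace transform of `I₀(2x√(ηt))`. -/
theorem integral_exp_mul_besselSeries {η ρ : ℝ} (hη : 0 < η) (hρ : 0 < ρ) (x : ℝ) :
    ∫ t, Real.exp (-(η / ρ) * t) * besselSeries (η * t * x ^ 2) ∂halfLine =
      ρ / η * Real.exp (ρ * x ^ 2) := by
  have hb : 0 < η / ρ := div_pos hη hρ
  set F : ℕ → ℝ → ℝ := fun k t =>
    (η * x ^ 2) ^ k / (k.factorial : ℝ) ^ 2 * (t ^ k * Real.exp (-(η / ρ) * t)) with hF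
  have hint : ∀ k, Integrable (F k) halfLine := fun k =>
    (integrableOn_pow_mul_exp_neg_mul hb k).const_mul _
  -- The Gamma integral supplies k!, which reduces 1/k!² to the coefficient of the exponential
  -- series.
  have hval : ∀ k, ∫ t, F k t ∂halfLine = ρ / η * ((ρ * x ^ 2) ^ k / k.factorial) := by
    intro k
    rw [hF]
    simp only
    rw [integral_const_mul, integral_pow_mul_exp_neg_mul hb]
    have : (k.factorial : ℝ) ≠ 0 := by positivity
    rw [div_pow, mul_pow, mul_pow, pow_succ η, pow_succ ρ]
    field_simp
  have hnorm : ∀ k, ∫ t, ‖F k t‖ ∂halfLine = ρ / η * ((ρ * x ^ 2) ^ k / k.factorial) := by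
    intro k
    rw [← hval]
    refine integral_congr_ae ?_
    filter_upwards [ae_restrict_mem measurableSet_Ioi] with t ht
    have ht : 0 < t := ht
    rw [Real.norm_eq_abs, abs_of_nonneg]
    simp only [hF]
    positivity
  have hs : Summable fun k => ∫ t, ‖F k t‖ ∂halfLine := by
    simp_rw [hnorm]
    exact (Real.summable_pow_div_factorial _).mul_left _
  have h := hasSum_integral_of_summable_integral_norm hint hs
  simp_rw [hval] at h
  have h2 : HasSum (fun k : ℕ => ρ / η * ((ρ * x ^ 2) ^ k / k.factorial))
      (ρ / η * Real.exp (ρ * x ^ 2)) := by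
    refine HasSum.mul_left _ ?_
    rw [Real.exp_eq_exp_ℝ]
    exact NormedSpace.expSeries_div_hasSum_exp _
  rw [← h.unique h2]
  congr 1; ext t
  rw [besselSeries, ← tsum_mul_left]
  congr 1; ext k
  simp only [hF]
  ring

/-! ### The form on Gaussians -/

theorem integral_abs_mul_exp_neg_mul_sq {c : ℝ} (hc : 0 < c) :
    ∫ x : ℝ, |x| * Real.exp (-c * x ^ 2) = 1 / c := by
  have h1 := integral_comp_abs (f := fun x : ℝ => x * Real.exp (-c * x ^ 2))
  simp only [sq_abs] at h1
  have h2 := integral_rpow_mul_exp_neg_mul_rpow (p := 2) (q := 1) (b := c) (by norm_num)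
    (by norm_num) hc
  simp only [Real.rpow_one, Real.rpow_ofNat] at h2
  rw [h1, h2]
  norm_num
  rw [Real.rpow_neg_one]
  ring

theorem integrable_abs_mul_exp_neg_mul_sq {c : ℝ} (hc : 0 < c) :
    Integrable fun x : ℝ => |x| * Real.exp (-c * x ^ 2) := by
  have := (integrable_mul_exp_neg_mul_sq hc).abs
  simpa only [abs_mul, Real.abs_exp] using this

theorem inv_add_mul_sq_eq {a b : ℝ} (ha : 0 < a) (hb : 0 < b) (t : ℝ) :
    (a + b * t ^ 2)⁻¹ = a⁻¹ * (1 + (√(b / a) * t) ^ 2)⁻¹ := by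
  rw [mul_pow, Real.sq_sqrt (by positivity), ← mul_inv]
  congr 1
  field_simp

theorem integrable_inv_add_mul_sq {a b : ℝ} (ha : 0 < a) (hb : 0 < b) :
    Integrable fun t : ℝ => (a + b * t ^ 2)⁻¹ := by
  simp_rw [inv_add_mul_sq_eq ha hb]
  have h : √(b / a) ≠ 0 := (Real.sqrt_pos.2 (by positivity)).ne'
  exact (integrable_inv_one_add_sq.comp_mul_left' h).const_mul _

theorem integral_inv_add_mul_sq {a b : ℝ} (ha : 0 < a) (hb : 0 < b) :
    ∫ t : ℝ, (a + b * t ^ 2)⁻¹ = Real.pi / √(a * b) := by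
  simp_rw [inv_add_mul_sq_eq ha hb]
  rw [integral_const_mul, Measure.integral_comp_mul_left (fun t => (1 + t ^ 2)⁻¹),
    integral_univ_inv_one_add_sq, abs_of_nonneg (by positivity), smul_eq_mul,
    Real.sqrt_div hb.le, Real.sqrt_mul ha.le, inv_div]
  have h1 : √a ^ 2 = a := Real.sq_sqrt ha.le
  have h2 : √a ≠ 0 := (Real.sqrt_pos.2 ha).ne'
  have h3 : √b ≠ 0 := (Real.sqrt_pos.2 hb).ne'
  field_simp
  rw [h1]

theorem integral_odd_eq_zero {f : ℝ → ℝ} (hf : ∀ t, f (-t) = -f t) : ∫ t, f t = 0 := by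
  have h := integral_neg_eq_self f volume
  simp_rw [hf] at h
  rw [integral_neg] at h
  linarith

/-- The cross term −2t of (1 − t)² is odd and drops out. The rest splits into partial fractions,
each integrating to an arctangent. -/
theorem integral_one_sub_sq_div {a b : ℝ} (ha : 0 < a) (hb : 0 < b) :
    ∫ t : ℝ, (1 - t) ^ 2 / ((a + b * t ^ 2) * (b + a * t ^ 2)) =
      2 * Real.pi / ((a + b) * √(a * b)) := by
  have hA := integrable_inv_add_mul_sq ha hb
  have hB := integrable_inv_add_mul_sq hb ha
  have hS : Integrable fun t : ℝ => (a + b)⁻¹ * ((a + b * t ^ 2)⁻¹ + (b + a * t ^ 2)⁻¹) :=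
    (hA.add hB).const_mul (a + b)⁻¹
  have hpf : ∀ t : ℝ, (1 + t ^ 2) / ((a + b * t ^ 2) * (b + a * t ^ 2)) =
      (a + b)⁻¹ * ((a + b * t ^ 2)⁻¹ + (b + a * t ^ 2)⁻¹) := by
    intro t
    have h1 : a + b * t ^ 2 ≠ 0 := by positivity
    have h2 : b + a * t ^ 2 ≠ 0 := by positivity
    field_simp
    ring
  have hO : Integrable fun t : ℝ => 2 * t / ((a + b * t ^ 2) * (b + a * t ^ 2)) := by
    refine hS.mono' (Measurable.aestronglyMeasurable (by fun_prop)) (ae_of_all _ fun t => ?_)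
    rw [← hpf, Real.norm_eq_abs, abs_div,
      abs_of_pos (by positivity : 0 < (a + b * t ^ 2) * (b + a * t ^ 2))]
    gcongr
    rw [abs_mul, abs_of_pos two_pos, ← sq_abs t]
    linarith [sq_nonneg (1 - |t|)]
  have hsplit : ∀ t : ℝ, (1 - t) ^ 2 / ((a + b * t ^ 2) * (b + a * t ^ 2)) =
      (a + b)⁻¹ * ((a + b * t ^ 2)⁻¹ + (b + a * t ^ 2)⁻¹) -
        2 * t / ((a + b * t ^ 2) * (b + a * t ^ 2)) := by
    intro t
    rw [← hpf, ← sub_div]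
    congr 1; ring
  simp_rw [hsplit]
  rw [integral_sub hS hO, integral_odd_eq_zero (f := fun t => 2 * t / _), integral_const_mul,
    integral_add hA hB, integral_inv_add_mul_sq ha hb, integral_inv_add_mul_sq hb ha, mul_comm b a]
  · have : √(a * b) ≠ 0 := (Real.sqrt_pos.2 (by positivity)).ne'
    field_simp
    ring
  · intro t
    rw [neg_sq, mul_neg, neg_div]

/-- The substitution `y = x t`. -/
theorem integral_prod_eq_integral_slope {f : ℝ × ℝ → ℝ} (hf : Integrable f) (hm : Measurable f) :
    ∫ p, f p = ∫ t : ℝ, ∫ x : ℝ, |x| * f (x, x * t) := by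
  have hf' : Integrable f (volume.prod volume) := hf
  have hx0 : ∀ᵐ x : ℝ, x ≠ 0 := by
    simp [ae_iff]
  have hcv : ∀ (h : ℝ → ℝ) (x : ℝ), x ≠ 0 → ∫ t, |x| * h (x * t) = ∫ y, h y := by
    intro h x hx
    rw [integral_const_mul, Measure.integral_comp_mul_left, abs_inv, smul_eq_mul, ← mul_assoc,
      mul_inv_cancel₀ (abs_ne_zero.2 hx), one_mul]
  have hmg : Measurable fun p : ℝ × ℝ => |p.1| * f (p.1, p.1 * p.2) := by
    have : Measurable fun p : ℝ × ℝ => f (p.1, p.1 * p.2) :=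
      hm.comp (measurable_fst.prodMk (measurable_fst.mul measurable_snd))
    fun_prop
  obtain ⟨h1, h2⟩ := (integrable_prod_iff hf'.aestronglyMeasurable).1 hf'
  have hint : Integrable (fun p : ℝ × ℝ => |p.1| * f (p.1, p.1 * p.2)) (volume.prod volume) := by
    refine (integrable_prod_iff hmg.aestronglyMeasurable).2 ⟨?_, h2.congr ?_⟩
    · filter_upwards [h1, hx0] with x hx hx0
      exact (hx.comp_mul_left' hx0).const_mul _
    · filter_upwards [hx0] with x hx0
      rw [← hcv _ x hx0]
      congr 1; ext t
      simp only [norm_mul, Real.norm_eq_abs, abs_abs]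
  calc ∫ p, f p = ∫ x, ∫ y, f (x, y) := integral_prod f hf'
    _ = ∫ x, ∫ t, |x| * f (x, x * t) := by
        refine integral_congr_ae ?_
        filter_upwards [hx0] with x hx0
        exact (hcv (fun y => f (x, y)) x hx0).symm
    _ = _ := integral_integral_swap hint

/-- In the coordinates (x, t) with y = xt the rational weight is (1 − t)/(1 + t), independent of x.
The x-integrals are elementary, and their difference contains 1 − t², which removes the pole at t =
−1. -/
theorem schurForm_exp {ρ ρ' : ℝ} (h0 : 0 ≤ ρ) (h1 : ρ < 1 / 2) (h0' : 0 ≤ ρ') (h1' : ρ' < 1 / 2) :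
    schurForm (fun x => Real.exp (ρ * x ^ 2)) (fun x => Real.exp (ρ' * x ^ 2)) =
      2 * Real.pi * (ρ - ρ') / ((1 - ρ - ρ') * √((1 / 2 - ρ) * (1 / 2 - ρ'))) := by
  have hint := (gaussGrowth_exp h0 (by linarith)).integrable (gaussGrowth_exp h0' (by linarith)) h1
    h1' (measurable_exp_mul_sq ρ) (measurable_exp_mul_sq ρ')
  have hm := measurable_schurIntegrand (measurable_exp_mul_sq ρ) (measurable_exp_mul_sq ρ')
  rw [schurForm, integral_prod_eq_integral_slope hint hm]
  set a := 1 / 2 - ρ with ha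
  set b := 1 / 2 - ρ' with hb
  have ha0 : 0 < a := sub_pos.2 h1
  have hb0 : 0 < b := sub_pos.2 h1'
  have hinner : ∀ t : ℝ, t ≠ -1 → ∫ x : ℝ, |x| * schurIntegrand (fun x => Real.exp (ρ * x ^ 2))
      (fun x => Real.exp (ρ' * x ^ 2)) (x, x * t) =
      (b - a) * ((1 - t) ^ 2 / ((a + b * t ^ 2) * (b + a * t ^ 2))) := by
    intro t ht
    have ht : 1 + t ≠ 0 := fun h => ht (by linarith)
    have hA : 0 < a + b * t ^ 2 := by positivity
    have hB : 0 < b + a * t ^ 2 := by positivity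
    have heq : ∀ x : ℝ, |x| * schurIntegrand (fun x => Real.exp (ρ * x ^ 2))
        (fun x => Real.exp (ρ' * x ^ 2)) (x, x * t) =
        (1 - t) / (1 + t) * (|x| * Real.exp (-(a + b * t ^ 2) * x ^ 2) -
          |x| * Real.exp (-(b + a * t ^ 2) * x ^ 2)) := by
      intro x
      by_cases hx : x = 0
      · simp [hx]
      have hfrac : (x - x * t) / (x + x * t) = (1 - t) / (1 + t) := by
        rw [show x - x * t = x * (1 - t) by ring, show x + x * t = x * (1 + t) by ring,
          mul_div_mul_left _ _ hx]
      have hE1 : Real.exp (-(a + b * t ^ 2) * x ^ 2) =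
          Real.exp (-(1 / 2) * (x ^ 2 + (x * t) ^ 2)) *
            (Real.exp (ρ * x ^ 2) * Real.exp (ρ' * (x * t) ^ 2)) := by
        rw [← Real.exp_add, ← Real.exp_add, ha, hb]; ring_nf
      have hE2 : Real.exp (-(b + a * t ^ 2) * x ^ 2) =
          Real.exp (-(1 / 2) * (x ^ 2 + (x * t) ^ 2)) *
            (Real.exp (ρ * (x * t) ^ 2) * Real.exp (ρ' * x ^ 2)) := by
        rw [← Real.exp_add, ← Real.exp_add, ha, hb]; ring_nf
      simp only [schurIntegrand, schurWeight]
      rw [hfrac, hE1, hE2]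
      ring
    simp_rw [heq]
    rw [integral_const_mul, integral_sub (integrable_abs_mul_exp_neg_mul_sq hA)
      (integrable_abs_mul_exp_neg_mul_sq hB), integral_abs_mul_exp_neg_mul_sq hA,
      integral_abs_mul_exp_neg_mul_sq hB]
    field_simp
    ring
  have hae : ∀ᵐ t : ℝ, t ≠ -1 := by
    simp [ae_iff]
  rw [integral_congr_ae (hae.mono hinner), integral_const_mul, integral_one_sub_sq_div ha0 hb0,
    show b - a = ρ - ρ' by rw [ha, hb]; ring, show 1 - ρ - ρ' = a + b by rw [ha, hb]; ring]
  ring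

/-! ### The extended ensemble in terms of the skew-symmetric form -/

/-- `x ↦ exp(ρ x²)`. -/
noncomputable def gaussFun (ρ x : ℝ) : ℝ := Real.exp (ρ * x ^ 2)

/-- `x ↦ I₀(2x√s)`. -/
noncomputable def besselFun (s x : ℝ) : ℝ := besselSeries (s * x ^ 2)

theorem measurable_gaussFun (ρ : ℝ) : Measurable (gaussFun ρ) := measurable_exp_mul_sq ρ

theorem measurable_besselFun (s : ℝ) : Measurable (besselFun s) :=
  measurable_besselSeries.comp (by fun_prop)

theorem calEIntegrand_eq {u v : ℝ} (hu : 0 ≤ u) (hv : 0 ≤ v) :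
    calEIntegrand u v = schurIntegrand (besselFun u) (besselFun v) := by
  ext p
  simp only [calEIntegrand, besselI0_two_mul_sqrt hu, besselI0_two_mul_sqrt hv, schurIntegrand,
    besselFun]

theorem calE_eq {u v : ℝ} (hu : 0 ≤ u) (hv : 0 ≤ v) :
    calE u v = schurForm (besselFun u) (besselFun v) := by
  rw [calE, calEIntegrand_eq hu hv, schurForm]

theorem hIntegrand_eq {η u : ℝ} (h : 0 ≤ η * u) (ρ : ℝ) :
    hIntegrand η ρ u = schurIntegrand (gaussFun ρ) (besselFun (η * u)) := by
  ext p
  simp only [hIntegrand, besselI0_two_mul_sqrt h, schurIntegrand, besselFun, gaussFun]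
  ring

theorem alphaIntegrand_eq (ρ ρ' : ℝ) :
    alphaIntegrand ρ ρ' = schurIntegrand (gaussFun ρ) (gaussFun ρ') := by
  ext p
  simp only [alphaIntegrand, schurIntegrand, gaussFun]
  ring

theorem gaussGrowth_gaussFun {ρ : ℝ} (hρ : ρ ∈ Ioo (0 : ℝ) (1 / 2)) :
    GaussGrowth ρ 1 (gaussFun ρ) :=
  gaussGrowth_exp hρ.1.le (by linarith [hρ.2])

/-- The value 1/4 is arbitrary in (0, 1/2). -/
theorem gaussGrowth_besselFun {s : ℝ} (hs : 0 ≤ s) :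
    GaussGrowth (1 / 4) ((1 + s) * Real.exp (s / (1 / 4))) (besselFun s) :=
  gaussGrowth_besselSeries hs (by norm_num)

theorem integrable_calEIntegrand {u v : ℝ} (hu : 0 ≤ u) (hv : 0 ≤ v) :
    Integrable (calEIntegrand u v) := by
  rw [calEIntegrand_eq hu hv]
  exact (gaussGrowth_besselFun hu).integrable (gaussGrowth_besselFun hv) (by norm_num)
    (by norm_num) (measurable_besselFun u) (measurable_besselFun v)

theorem integrable_hIntegrand {η u ρ : ℝ} (h : 0 ≤ η * u) (hρ : ρ ∈ Ioo (0 : ℝ) (1 / 2)) :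
    Integrable (hIntegrand η ρ u) := by
  rw [hIntegrand_eq h]
  exact (gaussGrowth_gaussFun hρ).integrable (gaussGrowth_besselFun h) hρ.2
    (by norm_num) (measurable_gaussFun ρ) (measurable_besselFun _)

theorem integrable_alphaIntegrand {ρ ρ' : ℝ} (hρ : ρ ∈ Ioo (0 : ℝ) (1 / 2))
    (hρ' : ρ' ∈ Ioo (0 : ℝ) (1 / 2)) : Integrable (alphaIntegrand ρ ρ') := by
  rw [alphaIntegrand_eq]
  exact (gaussGrowth_gaussFun hρ).integrable (gaussGrowth_gaussFun hρ') hρ.2 hρ'.2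
    (measurable_gaussFun ρ) (measurable_gaussFun ρ')

/-- Fubini moves the t-integral inside the form, where it is the Laplace transform of the Bessel
function. This single rule yields εφ_k, the Gram matrix and the integrals against 𝓔. -/
theorem GaussGrowth.integral_exp_mul_schurForm {c C η ρ : ℝ} {F : ℝ → ℝ} (hF : GaussGrowth c C F)
    (hc : c < 1 / 2) (hFm : Measurable F) (hη : 0 < η) (hρ : ρ ∈ Ioo (0 : ℝ) (1 / 2)) :
    Integrable (fun t => Real.exp (-(η / ρ) * t) * schurForm F (besselFun (η * t))) halfLine ∧
      ∫ t, Real.exp (-(η / ρ) * t) * schurForm F (besselFun (η * t)) ∂halfLine =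
        ρ / η * schurForm F (gaussFun ρ) := by
  -- The growth exponent κ must be below 1/2 for integrability against the weight, and above ρ so
  -- that exp(−ηt/ρ) beats the cost exp(ηt/κ) of the Bessel bound.
  obtain ⟨κ, h1, h2⟩ := exists_between hρ.2
  have hρ0 := hρ.1
  have hκ0 : 0 < κ := hρ0.trans h1
  have hm : Measurable (Function.uncurry fun t => besselFun (η * t)) :=
    measurable_besselSeries.comp
      (by fun_prop : Measurable fun p : ℝ × ℝ => η * p.1 * p.2 ^ 2)
  have hb : 0 < η / ρ - η / κ := sub_pos.2 (by gcongr)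
  have hφ : Integrable (fun t => |Real.exp (-(η / ρ) * t)| *
      ((1 + η * t) * Real.exp (η * t / κ))) halfLine := by
    refine ((integrableOn_pow_mul_exp_neg_mul hb 0).add
      ((integrableOn_pow_mul_exp_neg_mul hb 1).const_mul η)).congr (ae_of_all _ fun t => ?_)
    have : Real.exp (-(η / ρ - η / κ) * t) =
        Real.exp (-(η / ρ) * t) * Real.exp (η * t / κ) := by
      rw [← Real.exp_add]; congr 1; ring
    simp only [Pi.add_apply, Real.abs_exp]
    rw [this]
    ring
  have h := hF.integral_mul_schurForm (G := fun t => besselFun (η * t))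
    (φ := fun t => Real.exp (-(η / ρ) * t)) (fun t ht =>
      gaussGrowth_besselSeries (mul_pos hη ht).le hκ0) hc h2 hFm hm (by fun_prop) hφ
  refine ⟨h.1, h.2.trans ?_⟩
  rw [← schurForm_const_mul_right]
  congr 1; ext x
  exact integral_exp_mul_besselSeries hη hρ0 x

/-- The factor relating `εφ_k` to the form on Gaussians. -/
noncomputable def rowScale {N n : ℕ} (η : ℝ) (ϱ : Fin N ⊕ Fin n → ℝ) : Fin N ⊕ Fin n → ℝ
  | Sum.inl k => ϱ (Sum.inl k) / η
  | Sum.inr a => -η ^ (a : ℕ)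

section Ensemble

variable {N n : ℕ} {τ : ℝ} {σ : Fin N → ℝ} {r : Fin n → ℝ}

theorem etaMinus_pos (hτ : τ ∈ Ioo (0 : ℝ) 1) : 0 < etaMinus τ := by
  have h0 := hτ.1
  have h1 := hτ.2
  exact div_pos h0 (by nlinarith)

theorem varrho_mem (hτ : τ ∈ Ioo (0 : ℝ) 1) (hσ : ∀ j, τ < σ j)
    (hr : ∀ a, r a ∈ Ioo (0 : ℝ) (1 / 2)) (k : Fin N ⊕ Fin n) :
    varrho τ σ r k ∈ Ioo (0 : ℝ) (1 / 2) := by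
  have h0 := hτ.1
  rcases k with k | a
  · have h1 := hσ k
    refine ⟨div_pos h0 (by linarith), ?_⟩
    rw [varrho, div_lt_div_iff₀ (by linarith) (by norm_num)]
    linarith
  · exact hr a

/-- Both exponents equal (σ_j + τ)/(1 − τ²). -/
theorem extendedEnsemble_phi (hτ : τ ∈ Ioo (0 : ℝ) 1) (hσ : ∀ j, τ < σ j) (j : Fin N) (u : ℝ) :
    (extendedEnsemble τ σ r).phi j u =
      Real.exp (-(etaMinus τ / varrho τ σ r (Sum.inl j)) * u) := by
  have h0 := hτ.1
  have h1 := hτ.2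
  have h2 : 1 - τ ^ 2 ≠ 0 := by nlinarith
  have h3 := h0.ne'
  have h4 : σ j + τ ≠ 0 := by linarith [hσ j]
  simp only [extendedEnsemble, varrho, etaPlus, etaMinus]
  congr 2
  field_simp

theorem extendedEnsemble_eps (hτ : τ ∈ Ioo (0 : ℝ) 1) {u v : ℝ} (hu : 0 < u) (hv : 0 < v) :
    (extendedEnsemble τ σ r).eps u v =
      schurForm (besselFun (etaMinus τ * u)) (besselFun (etaMinus τ * v)) :=
  calE_eq (mul_pos (etaMinus_pos hτ) hu).le (mul_pos (etaMinus_pos hτ) hv).le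

theorem integrable_eps_mul_phi (hτ : τ ∈ Ioo (0 : ℝ) 1) (hσ : ∀ j, τ < σ j)
    (hr : ∀ a, r a ∈ Ioo (0 : ℝ) (1 / 2)) (k : Fin N) {u : ℝ} (hu : 0 < u) :
    Integrable (fun t => (extendedEnsemble τ σ r).eps u t * (extendedEnsemble τ σ r).phi k t)
      halfLine ∧
    ∫ t, (extendedEnsemble τ σ r).eps u t * (extendedEnsemble τ σ r).phi k t ∂halfLine =
      varrho τ σ r (Sum.inl k) / etaMinus τ *
        schurForm (besselFun (etaMinus τ * u)) (gaussFun (varrho τ σ r (Sum.inl k))) := by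
  have h := (gaussGrowth_besselFun (mul_pos (etaMinus_pos hτ) hu).le).integral_exp_mul_schurForm
    (by norm_num) (measurable_besselFun _) (etaMinus_pos hτ) (varrho_mem hτ hσ hr (Sum.inl k))
  have heq : ∀ᵐ t ∂halfLine, Real.exp (-(etaMinus τ / varrho τ σ r (Sum.inl k)) * t) *
      schurForm (besselFun (etaMinus τ * u)) (besselFun (etaMinus τ * t)) =
      (extendedEnsemble τ σ r).eps u t * (extendedEnsemble τ σ r).phi k t := by
    filter_upwards [ae_restrict_mem measurableSet_Ioi] with t ht
    rw [extendedEnsemble_phi hτ hσ, extendedEnsemble_eps hτ hu ht, mul_comm]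
  exact ⟨h.1.congr heq, (integral_congr_ae heq).symm.trans h.2⟩

/-- The functions h_a have the shape of the genuine εφ_k with the arguments of the form swapped,
whence the minus sign in `rowScale`. -/
theorem extendedEnsemble_epsPhi (hτ : τ ∈ Ioo (0 : ℝ) 1) (hσ : ∀ j, τ < σ j)
    (hr : ∀ a, r a ∈ Ioo (0 : ℝ) (1 / 2)) (k : Fin N ⊕ Fin n) {u : ℝ} (hu : 0 < u) :
    (extendedEnsemble τ σ r).epsPhi halfLine k u = rowScale (etaMinus τ) (varrho τ σ r) k *
      schurForm (besselFun (etaMinus τ * u)) (gaussFun (varrho τ σ r k)) := by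
  rcases k with k | a
  · exact (integrable_eps_mul_phi hτ hσ hr k hu).2
  · simp only [EnsembleData.epsPhi, extendedEnsemble, rowScale, varrho,
      hIntegrand_eq (mul_pos (etaMinus_pos hτ) hu).le]
    rw [← schurForm, schurForm_swap (besselFun _)]
    ring

theorem integral_phi_mul_epsPhi (hτ : τ ∈ Ioo (0 : ℝ) 1) (hσ : ∀ j, τ < σ j)
    (hr : ∀ a, r a ∈ Ioo (0 : ℝ) (1 / 2)) (j : Fin N) (k : Fin N ⊕ Fin n) :
    Integrable (fun t => (extendedEnsemble τ σ r).phi j t *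
      (extendedEnsemble τ σ r).epsPhi halfLine k t) halfLine ∧
    ∫ t, (extendedEnsemble τ σ r).phi j t * (extendedEnsemble τ σ r).epsPhi halfLine k t ∂halfLine =
      rowScale (etaMinus τ) (varrho τ σ r) (Sum.inl j) *
        schurForm (gaussFun (varrho τ σ r (Sum.inl j))) (gaussFun (varrho τ σ r k)) *
          rowScale (etaMinus τ) (varrho τ σ r) k := by
  have hk := varrho_mem hτ hσ hr k
  have h := (gaussGrowth_gaussFun hk).integral_exp_mul_schurForm hk.2 (measurable_gaussFun _)
    (etaMinus_pos hτ) (varrho_mem hτ hσ hr (Sum.inl j))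
  have heq : ∀ᵐ t ∂halfLine, -rowScale (etaMinus τ) (varrho τ σ r) k *
      (Real.exp (-(etaMinus τ / varrho τ σ r (Sum.inl j)) * t) *
        schurForm (gaussFun (varrho τ σ r k)) (besselFun (etaMinus τ * t))) =
      (extendedEnsemble τ σ r).phi j t * (extendedEnsemble τ σ r).epsPhi halfLine k t := by
    filter_upwards [ae_restrict_mem measurableSet_Ioi] with t ht
    rw [extendedEnsemble_phi hτ hσ, extendedEnsemble_epsPhi hτ hσ hr k ht,
      schurForm_swap (gaussFun (varrho τ σ r k))]
    ring
  refine ⟨(h.1.const_mul _).congr heq, (integral_congr_ae heq).symm.trans ?_⟩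
  rw [integral_const_mul, h.2, schurForm_swap (gaussFun (varrho τ σ r (Sum.inl j)))]
  simp only [rowScale]
  ring

theorem extendedEnsemble_gram (hτ : τ ∈ Ioo (0 : ℝ) 1) (hσ : ∀ j, τ < σ j)
    (hr : ∀ a, r a ∈ Ioo (0 : ℝ) (1 / 2)) (j k : Fin N ⊕ Fin n) :
    (extendedEnsemble τ σ r).gram halfLine j k = rowScale (etaMinus τ) (varrho τ σ r) j *
      schurForm (gaussFun (varrho τ σ r j)) (gaussFun (varrho τ σ r k)) *
        rowScale (etaMinus τ) (varrho τ σ r) k := by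
  rcases j with j | a
  · exact (integral_phi_mul_epsPhi hτ hσ hr j k).2
  rcases k with k | b
  · simp only [EnsembleData.gram]
    simp_rw [mul_comm (EnsembleData.epsPhi _ _ _ _)]
    rw [(integral_phi_mul_epsPhi hτ hσ hr k (Sum.inr a)).2,
      schurForm_swap (gaussFun (varrho τ σ r (Sum.inr a)))]
    ring
  · simp only [EnsembleData.gram, extendedEnsemble, alphaIntegrand_eq, rowScale, varrho]
    rw [← schurForm, pow_add]
    ring

end Ensemble

/-! ### Contour integrals in a half-plane, with an excluded essential singularity at 0. -/

namespace Contour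

variable {Γ : Contour} {f g : ℂ → ℂ}

theorem curve_mem_support (Γ : Contour) (i : Fin Γ.m) {t : ℝ} (ht : t ∈ Icc (0 : ℝ) 1) :
    Γ.curve i t ∈ Γ.support :=
  mem_iUnion.2 ⟨i, mem_image_of_mem _ ht⟩

theorem isCompact_support (Γ : Contour) : IsCompact Γ.support :=
  isCompact_iUnion fun i => isCompact_Icc.image_of_continuousOn (Γ.continuousOn i)

theorem exists_norm_deriv_le (Γ : Contour) (i : Fin Γ.m) :
    ∃ B : ℝ, ∀ᵐ t ∂(volume.restrict (uIoc (0 : ℝ) 1)), ‖deriv (Γ.curve i) t‖ ≤ B := by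
  obtain ⟨P, -, -, B, hB⟩ := Γ.piecewiseC1 i
  refine ⟨B, ?_⟩
  -- The bound holds off `P` in the open interval; the endpoint 1 of `uIoc 0 1` is discarded as
  -- well.
  have h1 : ∀ᵐ t : ℝ, t ∉ ((insert 1 P : Finset ℝ) : Set ℝ) :=
    (Finset.countable_toSet _).ae_notMem _
  rw [uIoc_of_le zero_le_one]
  filter_upwards [ae_restrict_of_ae h1, ae_restrict_mem measurableSet_Ioc] with t h1 h2
  simp only [Finset.coe_insert, mem_insert_iff, not_or] at h1
  exact hB t ⟨⟨h2.1, lt_of_le_of_ne h2.2 h1.1⟩, h1.2⟩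

theorem intervalIntegrable_deriv (Γ : Contour) (i : Fin Γ.m) :
    IntervalIntegrable (deriv (Γ.curve i)) volume 0 1 := by
  obtain ⟨B, hB⟩ := Γ.exists_norm_deriv_le i
  rw [intervalIntegrable_iff]
  exact Measure.integrableOn_of_bounded (by simp) (measurable_deriv _).aestronglyMeasurable hB

theorem continuousOn_comp_curve (hf : ContinuousOn f Γ.support) (i : Fin Γ.m) :
    ContinuousOn (fun t => f (Γ.curve i t)) (uIcc 0 1) := by
  rw [uIcc_of_le zero_le_one]
  exact hf.comp (Γ.continuousOn i) fun t ht => Γ.curve_mem_support i ht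

theorem intervalIntegrable (hf : ContinuousOn f Γ.support) (i : Fin Γ.m) :
    IntervalIntegrable (fun t => f (Γ.curve i t) * deriv (Γ.curve i) t) volume 0 1 :=
  (Γ.intervalIntegrable_deriv i).continuousOn_mul (continuousOn_comp_curve hf i)

theorem integral_congr (h : ∀ z ∈ Γ.support, f z = g z) : Γ.integral f = Γ.integral g := by
  unfold integral
  congr 1
  refine Finset.sum_congr rfl fun i _ => intervalIntegral.integral_congr fun t ht => ?_
  rw [uIcc_of_le zero_le_one] at ht
  simp only [h _ (Γ.curve_mem_support i ht)]

theorem integral_add (hf : ContinuousOn f Γ.support) (hg : ContinuousOn g Γ.support) :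
    Γ.integral (fun z => f z + g z) = Γ.integral f + Γ.integral g := by
  unfold integral
  rw [← mul_add, ← Finset.sum_add_distrib]
  congr 1
  refine Finset.sum_congr rfl fun i _ => ?_
  rw [← intervalIntegral.integral_add (intervalIntegrable hf i) (intervalIntegrable hg i)]
  simp only [add_mul]

theorem integral_const_mul (c : ℂ) (f : ℂ → ℂ) :
    Γ.integral (fun z => c * f z) = c * Γ.integral f := by
  unfold integral
  rw [mul_left_comm]
  simp only [mul_assoc, intervalIntegral.integral_const_mul, Finset.mul_sum]

theorem integral_sum {κ : Type*} (s : Finset κ) {f : κ → ℂ → ℂ}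
    (hf : ∀ k ∈ s, ContinuousOn (f k) Γ.support) :
    Γ.integral (fun z => ∑ k ∈ s, f k z) = ∑ k ∈ s, Γ.integral (f k) := by
  unfold integral
  rw [← Finset.mul_sum, Finset.sum_comm]
  congr 1
  refine Finset.sum_congr rfl fun i _ => ?_
  rw [← intervalIntegral.integral_finsetSum fun k hk => intervalIntegrable (hf k hk) i]
  simp only [Finset.sum_mul]

theorem integral_eq_zero_of_hasDerivAt {F : ℂ → ℂ} (hF : ∀ z ∈ Γ.support, HasDerivAt F (f z) z)
    (hf : ContinuousOn f Γ.support) : Γ.integral f = 0 := by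
  unfold integral
  rw [Finset.sum_eq_zero, mul_zero]
  intro i _
  obtain ⟨P, hP, -, -⟩ := Γ.piecewiseC1 i
  rw [integral_eq_of_hasDerivAt_off_countable_of_le (fun t => F (Γ.curve i t)) _ zero_le_one
    P.countable_toSet _ _ (intervalIntegrable hf i)]
  · rw [Γ.closed i, sub_self]
  · have hc : ContinuousOn F Γ.support := fun z hz => (hF z hz).continuousAt.continuousWithinAt
    have := continuousOn_comp_curve hc i
    rwa [uIcc_of_le zero_le_one] at this
  · intro t ht
    exact (hF _ (Γ.curve_mem_support i (Ioo_subset_Icc_self ht.1))).comp_of_eq t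
      (hP t ht).hasDerivAt rfl

/-- A compact subset of a left half-plane lies in a disc inside the half-plane. -/
theorem exists_ball_of_isCompact {K : Set ℂ} (hK : IsCompact K) {a : ℝ}
    (h : K ⊆ {w : ℂ | w.re < a}) :
    ∃ (c : ℂ) (R : ℝ), K ⊆ Metric.ball c R ∧ Metric.ball c R ⊆ {w : ℂ | w.re < a} := by
  rcases K.eq_empty_or_nonempty with rfl | hne
  · exact ⟨0, 0, by simp, by simp⟩
  obtain ⟨w₀, hw₀, hmax⟩ := hK.exists_isMaxOn hne Complex.continuous_re.continuousOn
  obtain ⟨B, hB⟩ := hK.isBounded.exists_norm_le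
  set δ := a - w₀.re with hδ
  have hδ0 : 0 < δ := sub_pos.2 (h hw₀)
  -- The disc about a − R touches the line Re = a. A point w lies in it when (a − Re w)² + (Im w)² <
  -- 2R(a − Re w). The left side is at most (B + |a|)² + B² and a − Re w ≥ δ, so Rδ exceeding that
  -- bound suffices.
  set R := ((B + |a|) ^ 2 + B ^ 2 + δ ^ 2) / δ with hR
  have hB0 : 0 ≤ B := (norm_nonneg _).trans (hB _ hw₀)
  have hR0 : 0 < R := by positivity
  have hRδ : R * δ = (B + |a|) ^ 2 + B ^ 2 + δ ^ 2 := by rw [hR]; field_simp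
  refine ⟨((a - R : ℝ) : ℂ), R, fun w hw => ?_, fun w hw => ?_⟩
  · have h1 : w.re ≤ a - δ := by
      have := hmax hw
      simp only [mem_ofPred_eq] at this
      linarith
    have h2 := hB w hw
    have h3 : w.re ^ 2 + w.im ^ 2 ≤ B ^ 2 := by
      have := Complex.sq_norm w
      rw [Complex.normSq_apply] at this
      nlinarith [norm_nonneg w]
    rw [Metric.mem_ball, Complex.dist_eq, ← sq_lt_sq₀ (norm_nonneg _) hR0.le, Complex.sq_norm,
      Complex.normSq_apply]
    simp only [Complex.sub_re, Complex.ofReal_re, Complex.sub_im, Complex.ofReal_im, sub_zero]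
    have h4 : |w.re| ≤ B := (Complex.abs_re_le_norm w).trans h2
    have h5 : (a - w.re) ^ 2 ≤ (B + |a|) ^ 2 := by
      rw [← sq_abs]
      have : |a - w.re| ≤ B + |a| := (abs_sub _ _).trans (by linarith)
      gcongr
    nlinarith
  · rw [Metric.mem_ball, Complex.dist_eq] at hw
    have h1 := (Complex.re_le_norm _).trans_lt hw
    simp only [Complex.sub_re, Complex.ofReal_re] at h1
    simp only [mem_ofPred_eq]
    linarith

/-- Cauchy's theorem in the half-plane. -/
theorem integral_eq_zero_of_differentiableOn {a : ℝ} (hΓ : Γ.support ⊆ {w : ℂ | w.re < a})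
    (hf : DifferentiableOn ℂ f {w : ℂ | w.re < a}) : Γ.integral f = 0 := by
  obtain ⟨c, R, h1, h2⟩ := exists_ball_of_isCompact Γ.isCompact_support hΓ
  obtain ⟨F, hF⟩ := (hf.mono h2).isExactOn_ball
  exact integral_eq_zero_of_hasDerivAt (fun z hz => hF z (h1 hz)) (hf.continuousOn.mono hΓ)

theorem continuousOn_inv_pow (h0 : (0 : ℂ) ∉ Γ.support) (m : ℕ) :
    ContinuousOn (fun w : ℂ => w⁻¹ ^ m) Γ.support :=
  (continuousOn_inv₀.mono fun _ hz hz0 => h0 (hz0 ▸ hz)).pow m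

theorem continuousOn_inv_sub {ρ : ℂ} (hρ : ρ ∉ Γ.support) :
    ContinuousOn (fun w : ℂ => (w - ρ)⁻¹) Γ.support :=
  (continuousOn_id.sub continuousOn_const).inv₀ fun z hz h =>
    hρ ((sub_eq_zero.1 h : z = ρ) ▸ hz)

/-- The power −1 is the winding number about 0; all lower powers have primitives. -/
theorem integral_inv_pow_succ (h0 : Γ.Excludes 0) (m : ℕ) :
    Γ.integral (fun w => w⁻¹ ^ (m + 1)) = 0 := by
  rcases m with - | m
  · simpa [windingNumber] using h0.2
  · refine integral_eq_zero_of_hasDerivAt (F := fun w => -(m + 1 : ℂ)⁻¹ * w⁻¹ ^ (m + 1))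
      (fun z hz => ?_) (continuousOn_inv_pow h0.1 _)
    have hz0 : z ≠ 0 := fun h => h0.1 (h ▸ hz)
    have hm : (m + 1 : ℂ) ≠ 0 := Nat.cast_add_one_ne_zero m
    refine (((hasDerivAt_inv hz0).pow (m + 1)).const_mul _).congr_deriv ?_
    rw [Nat.add_sub_cancel]
    push_cast
    simp only [pow_succ, inv_pow]
    field_simp

variable {a : ℝ}

theorem isOpen_halfPlane (a : ℝ) : IsOpen {w : ℂ | w.re < a} :=
  isOpen_lt Complex.continuous_re continuous_const

/-- Splitting H = H(0) + w·`dslope H 0` lowers the pole order by one, until Cauchy's theorem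
applies. -/
theorem integral_inv_pow_mul (ha : 0 < a) (hΓ : Γ.support ⊆ {w : ℂ | w.re < a})
    (h0 : Γ.Excludes 0) (m : ℕ) {H : ℂ → ℂ} (hH : DifferentiableOn ℂ H {w : ℂ | w.re < a}) :
    Γ.integral (fun w => w⁻¹ ^ m * H w) = 0 := by
  induction m generalizing H with
  | zero => simpa using integral_eq_zero_of_differentiableOn hΓ hH
  | succ m ih =>
    have hD : DifferentiableOn ℂ (dslope H 0) {w : ℂ | w.re < a} :=
      (Complex.differentiableOn_dslope ((isOpen_halfPlane a).mem_nhds (by simpa using ha))).2 hH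
    rw [integral_congr (g := fun w => H 0 * w⁻¹ ^ (m + 1) + w⁻¹ ^ m * dslope H 0 w),
      integral_add, integral_const_mul, integral_inv_pow_succ h0, ih hD, mul_zero, add_zero]
    · exact continuousOn_const.mul (continuousOn_inv_pow h0.1 _)
    · exact (continuousOn_inv_pow h0.1 _).mul (hD.continuousOn.mono hΓ)
    · intro z hz
      have hz0 : z ≠ 0 := fun h => h0.1 (h ▸ hz)
      have := sub_smul_dslope H 0 z
      rw [sub_zero, smul_eq_mul] at this
      have : H z = H 0 + z * dslope H 0 z := by rw [this]; ring
      rw [this, pow_succ]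
      field_simp

/-- Induction on the partial fraction 1/(w(w − ρ)) = ρ⁻¹(1/(w − ρ) − 1/w); the pure powers of 1/w
contribute nothing. -/
theorem integral_inv_pow_mul_inv_sub (h0 : Γ.Excludes 0) {ρ : ℂ} (hρ0 : ρ ≠ 0)
    (hρ : ρ ∉ Γ.support) (m : ℕ) :
    Γ.integral (fun w => w⁻¹ ^ m * (w - ρ)⁻¹) = ρ⁻¹ ^ m * Γ.windingNumber ρ := by
  induction m with
  | zero => simp [windingNumber]
  | succ m ih =>
    rw [integral_congr (g := fun w => ρ⁻¹ * (w⁻¹ ^ m * (w - ρ)⁻¹) + -ρ⁻¹ * w⁻¹ ^ (m + 1)),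
      integral_add, integral_const_mul, integral_const_mul, ih, integral_inv_pow_succ h0]
    · ring
    · exact continuousOn_const.mul ((continuousOn_inv_pow h0.1 _).mul (continuousOn_inv_sub hρ))
    · exact continuousOn_const.mul (continuousOn_inv_pow h0.1 _)
    · intro z hz
      have hz0 : z ≠ 0 := fun h => h0.1 (h ▸ hz)
      have hzρ : z - ρ ≠ 0 := fun h => hρ (sub_eq_zero.1 h ▸ hz)
      simp only [inv_pow, pow_succ]
      field_simp
      ring

theorem integral_inv_pow_mul_div_sub (ha : 0 < a) (hΓ : Γ.support ⊆ {w : ℂ | w.re < a})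
    (h0 : Γ.Excludes 0) {ρ : ℂ} (hρ0 : ρ ≠ 0) (hρ : ρ ∉ Γ.support) (hρa : ρ.re < a) (m : ℕ)
    {H : ℂ → ℂ} (hH : DifferentiableOn ℂ H {w : ℂ | w.re < a}) :
    Γ.integral (fun w => w⁻¹ ^ m * (H w * (w - ρ)⁻¹)) = ρ⁻¹ ^ m * (H ρ * Γ.windingNumber ρ) := by
  have hD : DifferentiableOn ℂ (dslope H ρ) {w : ℂ | w.re < a} :=
    (Complex.differentiableOn_dslope ((isOpen_halfPlane a).mem_nhds hρa)).2 hH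
  rw [integral_congr (g := fun w => H ρ * (w⁻¹ ^ m * (w - ρ)⁻¹) + w⁻¹ ^ m * dslope H ρ w),
    integral_add, integral_const_mul, integral_inv_pow_mul_inv_sub h0 hρ0 hρ,
    integral_inv_pow_mul ha hΓ h0 m hD]
  · ring
  · exact continuousOn_const.mul ((continuousOn_inv_pow h0.1 _).mul (continuousOn_inv_sub hρ))
  · exact (continuousOn_inv_pow h0.1 _).mul (hD.continuousOn.mono hΓ)
  · intro z hz
    have hzρ : z - ρ ≠ 0 := fun h => hρ (sub_eq_zero.1 h ▸ hz)
    have := sub_smul_dslope H ρ z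
    rw [smul_eq_mul] at this
    have : H z = H ρ + (z - ρ) * dslope H ρ z := by rw [this]; ring
    rw [this]
    field_simp

/-- Termwise integration of the exponential series of `exp(-c / w)`. -/
theorem hasSum_integral_exp (h0 : (0 : ℂ) ∉ Γ.support) (hf : ContinuousOn f Γ.support) (c : ℂ) :
    HasSum (fun m : ℕ => (-c) ^ m / m.factorial * Γ.integral fun w => w⁻¹ ^ m * f w)
      (Γ.integral fun w => Complex.exp (-c / w) * f w) := by
  -- The compact support avoids 0, so 1/w is bounded there and the exponential series is dominated
  -- uniformly.
  obtain ⟨A, hA⟩ := Γ.isCompact_support.exists_bound_of_continuousOn (continuousOn_inv_pow h0 1)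
  simp only [pow_one] at hA
  obtain ⟨C, hC⟩ := Γ.isCompact_support.exists_bound_of_continuousOn hf
  have hterm : ∀ i, HasSum (fun m : ℕ => ∫ t in (0 : ℝ)..1,
      (-c) ^ m / m.factorial * ((Γ.curve i t)⁻¹ ^ m * f (Γ.curve i t)) * deriv (Γ.curve i) t)
      (∫ t in (0 : ℝ)..1, Complex.exp (-c / Γ.curve i t) * f (Γ.curve i t) *
        deriv (Γ.curve i) t) := by
    intro i
    obtain ⟨B, hB⟩ := Γ.exists_norm_deriv_le i
    have hB' : ∀ᵐ t : ℝ, t ∈ uIoc (0 : ℝ) 1 → ‖deriv (Γ.curve i) t‖ ≤ B :=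
      (ae_restrict_iff' measurableSet_uIoc).1 hB
    have hmem : ∀ t ∈ uIoc (0 : ℝ) 1, Γ.curve i t ∈ Γ.support := fun t ht => by
      rw [uIoc_of_le zero_le_one] at ht
      exact Γ.curve_mem_support i (Ioc_subset_Icc_self ht)
    have hsum : Summable fun m : ℕ => (‖c‖ * A) ^ m / m.factorial * (C * B) :=
      (Real.summable_pow_div_factorial _).mul_right _
    refine intervalIntegral.hasSum_integral_of_dominated_convergence
      (fun m _ => (‖c‖ * A) ^ m / m.factorial * (C * B)) (fun m => ?_) (fun m => ?_) ?_ ?_ ?_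
    · have hc : ContinuousOn (fun w => (-c) ^ m / m.factorial * (w⁻¹ ^ m * f w)) Γ.support :=
        continuousOn_const.mul ((continuousOn_inv_pow h0 m).mul hf)
      exact (intervalIntegrable hc i).def'.aestronglyMeasurable
    · filter_upwards [hB'] with t ht htm
      have h1 := hA _ (hmem t htm)
      have h2 := hC _ (hmem t htm)
      have h3 := ht htm
      have hA0 := (norm_nonneg _).trans h1
      have hC0 := (norm_nonneg _).trans h2
      rw [norm_mul, norm_mul, norm_mul, norm_div, norm_pow, norm_pow, norm_neg,
        Complex.norm_natCast]
      calc _ ≤ ‖c‖ ^ m / m.factorial * (A ^ m * C) * B := by gcongr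
        _ = _ := by rw [mul_pow]; ring
    · exact ae_of_all _ fun _ _ => hsum
    · exact intervalIntegrable_const
    · refine ae_of_all _ fun t _ => ?_
      have := NormedSpace.expSeries_div_hasSum_exp (-c / Γ.curve i t)
      rw [← Complex.exp_eq_exp_ℂ] at this
      have heq : ∀ m : ℕ, (-c) ^ m / m.factorial * ((Γ.curve i t)⁻¹ ^ m * f (Γ.curve i t)) *
          deriv (Γ.curve i) t = (-c / Γ.curve i t) ^ m / m.factorial * f (Γ.curve i t) *
            deriv (Γ.curve i) t := fun m => by
        rw [div_eq_mul_inv (-c), mul_pow]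
        ring
      simp_rw [heq]
      exact (this.mul_right _).mul_right _
  have h := (hasSum_sum fun i (_ : i ∈ Finset.univ) => hterm i).mul_left
    (2 * Real.pi * Complex.I)⁻¹
  simp_rw [← integral_const_mul]
  exact h

end Contour

namespace Contour

variable {Γ : Contour} {f g : ℂ → ℂ} {a : ℝ}

theorem continuousOn_exp_div (h0 : (0 : ℂ) ∉ Γ.support) (c : ℂ) :
    ContinuousOn (fun w : ℂ => Complex.exp (-c / w)) Γ.support := by
  simp_rw [div_eq_mul_inv]
  have := continuousOn_inv_pow h0 1
  simp only [pow_one] at this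
  exact (continuousOn_const.mul this).cexp

/-- The contribution of a simple pole when the essential singularity at `0` is not encircled. -/
theorem integral_exp_mul_div_sub (ha : 0 < a) (hΓ : Γ.support ⊆ {w : ℂ | w.re < a})
    (h0 : Γ.Excludes 0) {ρ : ℂ} (hρ0 : ρ ≠ 0) (hρ : ρ ∉ Γ.support) (hρa : ρ.re < a) (c : ℂ)
    {H : ℂ → ℂ} (hH : DifferentiableOn ℂ H {w : ℂ | w.re < a}) :
    Γ.integral (fun w => Complex.exp (-c / w) * (w⁻¹ * (H w * (w - ρ)⁻¹))) =
      Complex.exp (-c / ρ) * (ρ⁻¹ * (H ρ * Γ.windingNumber ρ)) := by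
  have hf : ContinuousOn (fun w => w⁻¹ * (H w * (w - ρ)⁻¹)) Γ.support := by
    have := continuousOn_inv_pow h0.1 1
    simp only [pow_one] at this
    exact this.mul ((hH.continuousOn.mono hΓ).mul (continuousOn_inv_sub hρ))
  have h1 := hasSum_integral_exp h0.1 hf c
  have heq : ∀ m : ℕ, Γ.integral (fun w => w⁻¹ ^ m * (w⁻¹ * (H w * (w - ρ)⁻¹))) =
      ρ⁻¹ ^ m * (ρ⁻¹ * (H ρ * Γ.windingNumber ρ)) := by
    intro m
    have := integral_inv_pow_mul_div_sub ha hΓ h0 hρ0 hρ hρa (m + 1) hH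
    simpa only [pow_succ, mul_assoc] using this
  simp_rw [heq] at h1
  have h2 := (NormedSpace.expSeries_div_hasSum_exp (-c / ρ)).mul_right
    (ρ⁻¹ * (H ρ * Γ.windingNumber ρ))
  rw [← Complex.exp_eq_exp_ℂ] at h2
  refine h1.unique ?_
  have heq2 : ∀ m : ℕ, (-c) ^ m / m.factorial * (ρ⁻¹ ^ m * (ρ⁻¹ * (H ρ * Γ.windingNumber ρ))) =
      (-c / ρ) ^ m / m.factorial * (ρ⁻¹ * (H ρ * Γ.windingNumber ρ)) := fun m => by
    rw [div_eq_mul_inv (-c), mul_pow]; ring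
  simp_rw [heq2]
  exact h2

end Contour

/-- Lagrange interpolation of the constant 1, divided by the nodal polynomial. It needs a nonempty
index set: otherwise the product is 1 and the sum 0. -/
theorem prod_inv_sub_eq_sum {ι F : Type*} [Fintype ι] [DecidableEq ι] [Nonempty ι] [Field F]
    {v : ι → F} (hv : Function.Injective v) {x : F} (hx : ∀ k, x ≠ v k) :
    ∏ k, (x - v k)⁻¹ = ∑ k, (∏ l ∈ Finset.univ.erase k, (v k - v l)⁻¹) * (x - v k)⁻¹ := by
  have h := Lagrange.eval_interpolate_not_at_node (s := Finset.univ) (v := v) 1 fun k _ => hx k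
  rw [Lagrange.interpolate_one hv.injOn Finset.univ_nonempty, Polynomial.eval_one,
    Lagrange.eval_nodal] at h
  rw [Finset.prod_inv_distrib]
  refine inv_eq_of_mul_eq_one_right ?_
  rw [h]
  simp [Lagrange.nodalWeight]

/-! ### Residues for contours with prescribed winding numbers. -/

variable {ι : Type*} {ϱ : ι → ℝ} {A : Set ι} {Γ : Contour}

theorem IsWContour.notMem_support (h : IsWContour ϱ A Γ) (k : ι) : (ϱ k : ℂ) ∉ Γ.support := by
  by_cases hk : k ∈ A
  · exact (h.2.1 k hk).1
  · exact (h.2.2.1 k hk).1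

theorem IsWContour.windingNumber (h : IsWContour ϱ A Γ) (k : ι) :
    Γ.windingNumber (ϱ k : ℂ) = A.indicator 1 k := by
  by_cases hk : k ∈ A
  · simp [hk, (h.2.1 k hk).2]
  · simp [hk, (h.2.2.1 k hk).2]

theorem IsWContour.continuousOn_prod [Fintype ι] (h : IsWContour ϱ A Γ) :
    ContinuousOn (fun w : ℂ => ∏ k, (w - ϱ k)⁻¹) Γ.support :=
  continuousOn_finsetProd _ fun k _ => Contour.continuousOn_inv_sub (h.notMem_support k)

section Residues

variable [Fintype ι] [DecidableEq ι] [Nonempty ι]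

/-- The product `∏_{l ≠ k} (ϱ_k - ϱ_l)⁻¹`. -/
noncomputable def poleWeight (ϱ : ι → ℝ) (k : ι) : ℝ := ∏ l ∈ Finset.univ.erase k, (ϱ k - ϱ l)⁻¹

/-- The residue theorem for the contours of `IsWContour`. -/
theorem IsWContour.integral_eq (h : IsWContour ϱ A Γ) (hinj : Function.Injective ϱ)
    (hϱ : ∀ k, ϱ k ∈ Ioo (0 : ℝ) (1 / 2)) (c : ℂ) {H : ℂ → ℂ}
    (hH : DifferentiableOn ℂ H {w : ℂ | w.re < 1 / 2}) :
    Γ.integral (fun w => Complex.exp (-c / w) * (w⁻¹ * (H w * ∏ k, (w - ϱ k)⁻¹))) =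
      ∑ k, A.indicator 1 k * poleWeight ϱ k *
        (Complex.exp (-c / ϱ k) * ((ϱ k : ℂ)⁻¹ * H (ϱ k))) := by
  have h0 := h.2.2.2
  have hcinv := Contour.continuousOn_inv_pow h0.1 1
  simp only [pow_one] at hcinv
  rw [Contour.integral_congr (g := fun w => ∑ k, (poleWeight ϱ k : ℂ) *
    (Complex.exp (-c / w) * (w⁻¹ * (H w * (w - ϱ k)⁻¹)))), Contour.integral_sum]
  · refine Finset.sum_congr rfl fun k _ => ?_
    have hk0 : (ϱ k : ℂ) ≠ 0 := Complex.ofReal_ne_zero.2 (hϱ k).1.ne'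
    have hka : (ϱ k : ℂ).re < 1 / 2 := by simpa using (hϱ k).2
    rw [Contour.integral_const_mul, Contour.integral_exp_mul_div_sub (by norm_num) h.1 h0 hk0
      (h.notMem_support k) hka c hH, h.windingNumber]
    ring
  · intro k _
    exact continuousOn_const.mul ((Contour.continuousOn_exp_div h0.1 c).mul (hcinv.mul
      ((hH.continuousOn.mono h.1).mul (Contour.continuousOn_inv_sub (h.notMem_support k)))))
  · intro w hw
    have hinj' : Function.Injective fun k => (ϱ k : ℂ) := Complex.ofReal_injective.comp hinj
    have hx : ∀ k, w ≠ ϱ k := fun k hk => h.notMem_support k (hk ▸ hw)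
    rw [prod_inv_sub_eq_sum hinj' hx]
    simp only [Finset.mul_sum, poleWeight, Complex.ofReal_prod, Complex.ofReal_inv,
      Complex.ofReal_sub]
    refine Finset.sum_congr rfl fun k _ => ?_
    ring

end Residues

/-! ### Reflection of contours -/

/-- The image of a contour under `z ↦ 1 - z`. -/
def Contour.reflect (Γ : Contour) : Contour where
  m := Γ.m
  curve i t := 1 - Γ.curve i t
  continuousOn i := continuousOn_const.sub (Γ.continuousOn i)
  closed i := by rw [Γ.closed i]
  piecewiseC1 i := by
    obtain ⟨P, h1, h2, B, h3⟩ := Γ.piecewiseC1 i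
    have hd : deriv (fun t => 1 - Γ.curve i t) = fun t => -deriv (Γ.curve i) t := by
      ext t; exact deriv_const_sub _
    refine ⟨P, fun t ht => (h1 t ht).const_sub 1, ?_, B, fun t ht => ?_⟩
    · rw [hd]; exact h2.neg
    · rw [hd, norm_neg]; exact h3 t ht

namespace Contour

theorem integral_reflect (Γ : Contour) (f : ℂ → ℂ) :
    Γ.reflect.integral f = -Γ.integral fun z => f (1 - z) := by
  have hd : ∀ i, deriv (Γ.reflect.curve i) = fun t => -deriv (Γ.curve i) t := fun i => by
    ext t; exact deriv_const_sub _
  unfold integral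
  rw [← mul_neg, ← Finset.sum_neg_distrib]
  congr 1
  refine Finset.sum_congr rfl fun i _ => ?_
  rw [hd, ← intervalIntegral.integral_neg]
  simp only [mul_neg]
  rfl

theorem integral_eq_neg_reflect (Γ : Contour) (f : ℂ → ℂ) :
    Γ.integral f = -Γ.reflect.integral fun z => f (1 - z) := by
  rw [integral_reflect, neg_neg]
  simp only [sub_sub_cancel]

theorem mem_support_reflect {Γ : Contour} {z : ℂ} : z ∈ Γ.reflect.support ↔ 1 - z ∈ Γ.support := by
  simp only [support, mem_iUnion, mem_image]
  refine exists_congr fun i => exists_congr fun t => and_congr_right fun _ => ?_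
  change 1 - Γ.curve i t = z ↔ _
  constructor
  · rintro rfl; ring
  · intro h; rw [h]; ring

theorem windingNumber_reflect (Γ : Contour) (a : ℂ) :
    Γ.reflect.windingNumber a = Γ.windingNumber (1 - a) := by
  rw [windingNumber, integral_reflect, windingNumber, ← neg_one_mul, ← integral_const_mul]
  congr 1; ext z
  rw [neg_one_mul, ← inv_neg]
  congr 1; ring

theorem Encircles.reflect {Γ : Contour} {a : ℂ} (h : Γ.Encircles (1 - a)) :
    Γ.reflect.Encircles a :=
  ⟨fun h' => h.1 (mem_support_reflect.1 h'), by rw [windingNumber_reflect, h.2]⟩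

theorem Excludes.reflect {Γ : Contour} {a : ℂ} (h : Γ.Excludes (1 - a)) : Γ.reflect.Excludes a :=
  ⟨fun h' => h.1 (mem_support_reflect.1 h'), by rw [windingNumber_reflect, h.2]⟩

end Contour

theorem IsZContour.reflect (h : IsZContour ϱ A Γ) : IsWContour ϱ A Γ.reflect := by
  refine ⟨fun z hz => ?_, fun k hk => (h.2.1 k hk).reflect, fun k hk => (h.2.2.1 k hk).reflect,
    Contour.Excludes.reflect (by simpa using h.2.2.2)⟩
  have := h.1 (Contour.mem_support_reflect.1 hz)
  simp only [mem_ofPred_eq, Complex.sub_re, Complex.one_re] at this ⊢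
  linarith

/-! ### The double contour integral as a double sum over residues -/

section Kernel

variable {ι : Type*} [Fintype ι]

/-- The factor of the integrand which is regular in both half-planes, with `ζ = 1 - z`. -/
noncomputable def regularFactor (ϱ : ι → ℝ) (w ζ : ℂ) : ℂ :=
  1 / Complex.sqrt ((1 - 2 * ζ) * (1 - 2 * w)) * ((ζ - w) / (w + ζ - 1)) *
    ((∏ k, (1 - ζ - ϱ k)) * ∏ k, (1 - w - ϱ k))

/-- Antisymmetry transfers holomorphy from ζ to w. -/
theorem regularFactor_swap (ϱ : ι → ℝ) (w ζ : ℂ) :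
    regularFactor ϱ ζ w = -regularFactor ϱ w ζ := by
  unfold regularFactor
  rw [mul_comm (1 - 2 * w), add_comm ζ, mul_comm (∏ k, (1 - w - (ϱ k : ℂ))), ← neg_sub ζ w, neg_div]
  ring

/-- Two arguments in (−π/2, π/2) cannot add up to ±π, so the principal root has no branch cut on the
product of the half-planes. -/
theorem mul_mem_slitPlane {p q : ℂ} (hp : 0 < p.re) (hq : 0 < q.re) : p * q ∈ Complex.slitPlane := by
  rw [Complex.mem_slitPlane_iff]
  by_contra! h
  obtain ⟨h1, h2⟩ := h
  rw [Complex.mul_re] at h1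
  rw [Complex.mul_im] at h2
  have h3 : p.im * q.re = -(p.re * q.im) := by linarith
  have h4 : p.re * q.re * q.re ≤ p.im * q.im * q.re := by nlinarith
  have h5 : p.im * q.im * q.re = -(p.re * q.im ^ 2) := by
    rw [mul_right_comm, h3]; ring
  have h6 : 0 < p.re * q.re * q.re := by positivity
  have h7 : 0 ≤ p.re * q.im ^ 2 := by positivity
  linarith

theorem differentiableOn_regularFactor (ϱ : ι → ℝ) {w : ℂ} (hw : w.re < 1 / 2) :
    DifferentiableOn ℂ (regularFactor ϱ w) {ζ : ℂ | ζ.re < 1 / 2} := by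
  have hmem : ∀ ζ ∈ {ζ : ℂ | ζ.re < 1 / 2}, (1 - 2 * ζ) * (1 - 2 * w) ∈ Complex.slitPlane := by
    intro ζ hζ
    have hζ : ζ.re < 1 / 2 := hζ
    apply mul_mem_slitPlane <;> simp <;> linarith
  have hsqrt : DifferentiableOn ℂ (fun ζ => Complex.sqrt ((1 - 2 * ζ) * (1 - 2 * w)))
      {ζ : ℂ | ζ.re < 1 / 2} :=
    Complex.differentiableOn_sqrt.comp (by fun_prop) hmem
  have hne : ∀ ζ ∈ {ζ : ℂ | ζ.re < 1 / 2}, Complex.sqrt ((1 - 2 * ζ) * (1 - 2 * w)) ≠ 0 := by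
    intro ζ hζ
    have h0 := Complex.slitPlane_ne_zero (hmem ζ hζ)
    rw [Complex.sqrt, Complex.cpow_ne_zero_iff]
    exact Or.inl h0
  have hne' : ∀ ζ ∈ {ζ : ℂ | ζ.re < 1 / 2}, w + ζ - 1 ≠ 0 := by
    intro ζ hζ h
    have hζ : ζ.re < 1 / 2 := hζ
    have := congrArg Complex.re h
    simp at this
    linarith
  refine (((differentiableOn_const _).div hsqrt hne).mul
    (DifferentiableOn.div (by fun_prop) (by fun_prop) hne')).mul ?_
  fun_prop

theorem differentiableOn_regularFactor_left (ϱ : ι → ℝ) {ζ : ℂ} (hζ : ζ.re < 1 / 2) :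
    DifferentiableOn ℂ (fun w => regularFactor ϱ w ζ) {w : ℂ | w.re < 1 / 2} := by
  simp_rw [regularFactor_swap ϱ ζ]
  exact (differentiableOn_regularFactor ϱ hζ).neg

/-- With ζ = 1 − z both variables have their poles at the ϱ_k and their essential singularity at 0.
Only `regularFactor` couples them. -/
theorem contourIntegrand_one_sub (η : ℝ) (ϱ : ι → ℝ) (u v : ℝ) (w ζ : ℂ) :
    contourIntegrand η ϱ u v w (1 - ζ) =
      (Complex.exp (-(η * u : ℝ) / w) * (w⁻¹ * ∏ k, (w - ϱ k)⁻¹)) *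
        (Complex.exp (-(η * v : ℝ) / ζ) *
          (ζ⁻¹ * (regularFactor ϱ w ζ * ∏ k, (ζ - ϱ k)⁻¹))) := by
  have hexp : Complex.exp (-(η * u / w) - η * v / ζ) =
      Complex.exp (-(η * u : ℝ) / w) * Complex.exp (-(η * v : ℝ) / ζ) := by
    rw [← Complex.exp_add]
    push_cast
    congr 1; ring
  have hprod : ∏ k, ((1 - ζ - ϱ k) / (w - ϱ k) * ((1 - w - ϱ k) / (1 - (1 - ζ) - ϱ k))) =
      (∏ k, (1 - ζ - (ϱ k : ℂ))) * (∏ k, (1 - w - (ϱ k : ℂ))) *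
        ((∏ k, (w - (ϱ k : ℂ))⁻¹) * ∏ k, (ζ - (ϱ k : ℂ))⁻¹) := by
    rw [← Finset.prod_mul_distrib, ← Finset.prod_mul_distrib, ← Finset.prod_mul_distrib]
    refine Finset.prod_congr rfl fun k _ => ?_
    rw [sub_sub_cancel]
    ring
  have hfrac : (1 - (1 - ζ) - w) / (w - (1 - ζ)) = (ζ - w) / (w + ζ - 1) := by
    congr 1 <;> ring
  unfold contourIntegrand regularFactor
  rw [hprod, hfrac, sub_sub_cancel, hexp, show 2 * (1 - ζ) - 1 = 1 - 2 * ζ by ring, one_div (ζ * w),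
    mul_inv]
  ring

variable [DecidableEq ι]

/-- The coefficients of the double sum. -/
noncomputable def residueCoeff (ϱ : ι → ℝ) (j k : ι) : ℂ :=
  -(1 / (4 * Real.pi)) * (poleWeight ϱ j * poleWeight ϱ k * regularFactor ϱ (ϱ j) (ϱ k))

theorem contourKernel_eq_sum [Nonempty ι] {ϱ : ι → ℝ} (hinj : Function.Injective ϱ)
    (hϱ : ∀ k, ϱ k ∈ Ioo (0 : ℝ) (1 / 2)) {A B : Set ι} {Γw Γz : Contour}
    (hw : IsWContour ϱ A Γw) (hz : IsZContour ϱ B Γz) (η u v : ℝ) :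
    contourKernel η ϱ Γw Γz u v = ∑ j, ∑ k, A.indicator 1 j * B.indicator 1 k *
      ((η / ϱ j * Real.exp (-(η / ϱ j) * u) : ℝ) * residueCoeff ϱ j k *
        (η / ϱ k * Real.exp (-(η / ϱ k) * v) : ℝ)) := by
  have hre : ∀ k, (ϱ k : ℂ).re < 1 / 2 := fun k => by simpa using (hϱ k).2
  have hinner : ∀ w ∈ Γw.support, Γz.integral (fun z => contourIntegrand η ϱ u v w z) =
      ∑ k, -(B.indicator 1 k * poleWeight ϱ k * (Complex.exp (-(η * v : ℝ) / ϱ k) *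
        (ϱ k : ℂ)⁻¹)) * (Complex.exp (-(η * u : ℝ) / w) *
          (w⁻¹ * (regularFactor ϱ w (ϱ k) * ∏ k, (w - ϱ k)⁻¹))) := by
    intro w hws
    -- Reflection reverses dz; this is the minus sign in `residueCoeff`.
    rw [Contour.integral_eq_neg_reflect]
    simp_rw [contourIntegrand_one_sub]
    rw [Contour.integral_const_mul, hz.reflect.integral_eq hinj hϱ _
      (differentiableOn_regularFactor ϱ (hw.1 hws)), Finset.mul_sum, ← Finset.sum_neg_distrib]
    refine Finset.sum_congr rfl fun k _ => ?_
    ring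
  have h0 := hw.2.2.2
  have hcinv := Contour.continuousOn_inv_pow h0.1 1
  simp only [pow_one] at hcinv
  rw [contourKernel, Contour.integral_congr hinner, Contour.integral_sum]
  · simp_rw [Contour.integral_const_mul]
    have : ∀ k, Γw.integral (fun w => Complex.exp (-(η * u : ℝ) / w) *
          (w⁻¹ * (regularFactor ϱ w (ϱ k) * ∏ k, (w - ϱ k)⁻¹))) = _ := fun k =>
      hw.integral_eq hinj hϱ _ (differentiableOn_regularFactor_left ϱ (hre k))
    simp_rw [this, Finset.mul_sum]
    rw [Finset.sum_comm]
    refine Finset.sum_congr rfl fun j _ => Finset.sum_congr rfl fun k _ => ?_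
    have hexp : ∀ (x : ℝ) (i : ι), Complex.exp (-(η * x : ℝ) / ϱ i) =
        Real.exp (-(η / ϱ i) * x) := fun x i => by
      rw [Complex.ofReal_exp]
      push_cast
      congr 1; ring
    rw [hexp, hexp, residueCoeff]
    push_cast
    ring
  · intro k _
    exact continuousOn_const.mul ((Contour.continuousOn_exp_div h0.1 _).mul (hcinv.mul
      (((differentiableOn_regularFactor_left ϱ (hre k)).continuousOn.mono hw.1).mul
        hw.continuousOn_prod)))

/-- The coefficients of the double sum in terms of the inverse Schur matrix. -/
noncomputable def kernelCoeff (ϱ : ι → ℝ) (j k : ι) : ℝ :=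
  √(1 / 2 - ϱ j) * √(1 / 2 - ϱ k) * (schurCoeff (fun l => 1 / 2 - ϱ l) k *
    schurMat (fun l => 1 / 2 - ϱ l) k j * schurCoeff (fun l => 1 / 2 - ϱ l) j) / (2 * Real.pi)

/-- With a = 1/2 − ϱ, the factor l = k is 2a_k, and for l ≠ k one has 1 − ϱ_k − ϱ_l = a_k + a_l and
ϱ_k − ϱ_l = a_l − a_k. -/
theorem poleWeight_mul_prod (ϱ : ι → ℝ) (k : ι) :
    poleWeight ϱ k * ∏ l, (1 - ϱ k - ϱ l) =
      2 * (1 / 2 - ϱ k) * schurCoeff (fun l => 1 / 2 - ϱ l) k := by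
  rw [← Finset.mul_prod_erase _ _ (Finset.mem_univ k), poleWeight, schurCoeff, mul_left_comm,
    ← Finset.prod_mul_distrib]
  congr 1
  · ring
  · refine Finset.prod_congr rfl fun l _ => ?_
    rw [mul_comm, div_eq_mul_inv]
    congr 2 <;> ring

theorem residueCoeff_eq {ϱ : ι → ℝ} (hϱ : ∀ k, ϱ k ∈ Ioo (0 : ℝ) (1 / 2)) (j k : ι) :
    residueCoeff ϱ j k = kernelCoeff ϱ j k := by
  have hj : 0 < 1 / 2 - ϱ j := sub_pos.2 (hϱ j).2
  have hk : 0 < 1 / 2 - ϱ k := sub_pos.2 (hϱ k).2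
  have hsq : Complex.sqrt ((1 - 2 * ϱ k) * (1 - 2 * ϱ j)) =
      ((2 * (√(1 / 2 - ϱ j) * √(1 / 2 - ϱ k)) : ℝ) : ℂ) := by
    have h1 : (1 - 2 * ϱ k : ℂ) * (1 - 2 * ϱ j) =
        (((2 * (√(1 / 2 - ϱ j) * √(1 / 2 - ϱ k))) ^ 2 : ℝ) : ℂ) := by
      rw [mul_pow, mul_pow, Real.sq_sqrt hj.le, Real.sq_sqrt hk.le]
      push_cast
      ring
    rw [h1, Complex.sqrt_of_nonneg (by rw [Complex.zero_le_real]; positivity),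
      Complex.ofReal_re, Real.sqrt_sq (by positivity)]
  have hreg : regularFactor ϱ (ϱ j) (ϱ k) =
      ((1 / (2 * (√(1 / 2 - ϱ j) * √(1 / 2 - ϱ k))) * ((ϱ k - ϱ j) / (ϱ j + ϱ k - 1)) *
        ((∏ l, (1 - ϱ k - ϱ l)) * ∏ l, (1 - ϱ j - ϱ l)) : ℝ) : ℂ) := by
    rw [regularFactor, hsq]
    push_cast
    rfl
  rw [residueCoeff, hreg]
  norm_cast
  have h1 := poleWeight_mul_prod ϱ j
  have h2 := poleWeight_mul_prod ϱ k
  -- The denominator is −(a_j + a_k); this sign cancels the one in `residueCoeff`.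
  have h3 : (ϱ k - ϱ j) / (ϱ j + ϱ k - 1) = -schurMat (fun l => 1 / 2 - ϱ l) k j := by
    rw [schurMat, ← neg_div_neg_eq, ← neg_div]
    congr 1 <;> ring
  calc _ = -(1 / (4 * Real.pi)) * (1 / (2 * (√(1 / 2 - ϱ j) * √(1 / 2 - ϱ k)))) *
        ((ϱ k - ϱ j) / (ϱ j + ϱ k - 1)) * (poleWeight ϱ j * ∏ l, (1 - ϱ j - ϱ l)) *
          (poleWeight ϱ k * ∏ l, (1 - ϱ k - ϱ l)) := by ring
    _ = _ := by
      rw [h1, h2, h3, kernelCoeff]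
      have e1 := Real.sq_sqrt hj.le
      have e2 := Real.sq_sqrt hk.le
      set sj := √(1 / 2 - ϱ j)
      set sk := √(1 / 2 - ϱ k)
      have n1 : sj ≠ 0 := (Real.sqrt_pos.2 hj).ne'
      have n2 : sk ≠ 0 := (Real.sqrt_pos.2 hk).ne'
      rw [← e1, ← e2]
      field_simp
      ring

end Kernel

/-! ### Inversion of the Gram matrix -/

theorem rowScale_ne_zero {N n : ℕ} {η : ℝ} (hη : 0 < η) {ϱ : Fin N ⊕ Fin n → ℝ}
    (hϱ : ∀ k, ϱ k ∈ Ioo (0 : ℝ) (1 / 2)) (k : Fin N ⊕ Fin n) : rowScale η ϱ k ≠ 0 := by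
  rcases k with k | a
  · exact (div_pos (hϱ _).1 hη).ne'
  · exact neg_ne_zero.2 (pow_pos hη _).ne'

/-- The form on Gaussians is 2π times the Schur matrix conjugated by the a_k^(−1/2). `kernelCoeff`
carries the opposite square roots and 1/(2π), with transposed indices because the kernels use
c_{kj}. -/
theorem sum_schurForm_mul_kernelCoeff {ι : Type*} [Fintype ι] [DecidableEq ι] {ϱ : ι → ℝ}
    (hM : Even (Fintype.card ι)) (hinj : Function.Injective ϱ)
    (hϱ : ∀ k, ϱ k ∈ Ioo (0 : ℝ) (1 / 2)) (i j : ι) :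
    ∑ k, schurForm (gaussFun (ϱ i)) (gaussFun (ϱ k)) * kernelCoeff ϱ j k =
      if i = j then 1 else 0 := by
  set a : ι → ℝ := fun l => 1 / 2 - ϱ l with ha
  have ha0 : ∀ k, 0 < a k := fun k => sub_pos.2 (hϱ k).2
  have hainj : Function.Injective a := fun x y h => hinj (sub_right_injective h)
  have hs : ∀ k, √(a k) ≠ 0 := fun k => (Real.sqrt_pos.2 (ha0 k)).ne'
  have hterm : ∀ k, schurForm (gaussFun (ϱ i)) (gaussFun (ϱ k)) * kernelCoeff ϱ j k =
      √(a j) / √(a i) * schurCoeff a j * (schurMat a i k * schurCoeff a k * schurMat a k j) := by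
    intro k
    have h1 : schurForm (gaussFun (ϱ i)) (gaussFun (ϱ k)) =
        2 * Real.pi * schurMat a i k / (√(a i) * √(a k)) := by
      have h2 : a i + a k ≠ 0 := (add_pos (ha0 i) (ha0 k)).ne'
      have h3 := schurForm_exp (hϱ i).1.le (hϱ i).2 (hϱ k).1.le (hϱ k).2
      refine h3.trans ?_
      rw [show 1 - ϱ i - ϱ k = a i + a k by simp only [ha]; ring,
        show ϱ i - ϱ k = a k - a i by simp only [ha]; ring,
        show (1 / 2 - ϱ i) * (1 / 2 - ϱ k) = a i * a k from rfl, Real.sqrt_mul (ha0 i).le, schurMat]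
      have := hs i
      have := hs k
      field_simp
    rw [h1, kernelCoeff]
    have := hs i
    have := hs k
    change _ * (√(a j) * √(a k) * (schurCoeff a k * schurMat a k j * schurCoeff a j) /
      (2 * Real.pi)) = _
    field_simp
  simp_rw [hterm]
  rw [← Finset.mul_sum]
  split_ifs with h
  · subst h
    rw [sum_schurMat_mul_self hM ha0 hainj, div_self (hs i), one_mul,
      mul_inv_cancel₀ (schurCoeff_ne_zero ha0 hainj i)]
  · rw [sum_schurMat_mul_of_ne hM ha0 hainj h, mul_zero]

section Ensemble

variable {N n : ℕ} {τ : ℝ} {σ : Fin N → ℝ} {r : Fin n → ℝ}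

theorem gram_mul_eq_one (hM : Even (N + n)) (hτ : τ ∈ Ioo (0 : ℝ) 1) (hσ : ∀ j, τ < σ j)
    (hr : ∀ a, r a ∈ Ioo (0 : ℝ) (1 / 2)) (hinj : Function.Injective (varrho τ σ r)) :
    (extendedEnsemble τ σ r).gram halfLine * Matrix.of (fun k j =>
      kernelCoeff (varrho τ σ r) j k / (rowScale (etaMinus τ) (varrho τ σ r) k *
        rowScale (etaMinus τ) (varrho τ σ r) j)) = 1 := by
  have hd := rowScale_ne_zero (etaMinus_pos hτ) (varrho_mem hτ hσ hr)
  have hcard : Even (Fintype.card (Fin N ⊕ Fin n)) := by simpa using hM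
  ext i j
  rw [Matrix.mul_apply, Matrix.one_apply]
  have hterm : ∀ k, (extendedEnsemble τ σ r).gram halfLine i k * Matrix.of (fun k j =>
      kernelCoeff (varrho τ σ r) j k / (rowScale (etaMinus τ) (varrho τ σ r) k *
        rowScale (etaMinus τ) (varrho τ σ r) j)) k j =
      rowScale (etaMinus τ) (varrho τ σ r) i / rowScale (etaMinus τ) (varrho τ σ r) j *
        (schurForm (gaussFun (varrho τ σ r i)) (gaussFun (varrho τ σ r k)) *
          kernelCoeff (varrho τ σ r) j k) := by
    intro k
    rw [extendedEnsemble_gram hτ hσ hr, Matrix.of_apply]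
    have h1 := hd k
    have h2 := hd j
    field_simp
  simp_rw [hterm]
  rw [← Finset.mul_sum, sum_schurForm_mul_kernelCoeff hcard hinj (varrho_mem hτ hσ hr)]
  split_ifs with h
  · subst h; rw [div_self (hd i), one_mul]
  · rw [mul_zero]

theorem gram_inv_apply (hM : Even (N + n)) (hτ : τ ∈ Ioo (0 : ℝ) 1) (hσ : ∀ j, τ < σ j)
    (hr : ∀ a, r a ∈ Ioo (0 : ℝ) (1 / 2)) (hinj : Function.Injective (varrho τ σ r))
    (k j : Fin N ⊕ Fin n) :
    ((extendedEnsemble τ σ r).gram halfLine)⁻¹ k j =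
      kernelCoeff (varrho τ σ r) j k / (rowScale (etaMinus τ) (varrho τ σ r) k *
        rowScale (etaMinus τ) (varrho τ σ r) j) := by
  rw [Matrix.inv_eq_right_inv (gram_mul_eq_one hM hτ hσ hr hinj), Matrix.of_apply]

/-- The exponential `(η / ρ) exp(-(η / ρ) t)`. -/
noncomputable def expDensity (η ρ t : ℝ) : ℝ := η / ρ * Real.exp (-(η / ρ) * t)

theorem phi_div_rowScale (hτ : τ ∈ Ioo (0 : ℝ) 1) (hσ : ∀ j, τ < σ j) (j : Fin N) (u : ℝ) :
    (extendedEnsemble τ σ r).phi j u / rowScale (etaMinus τ) (varrho τ σ r) (Sum.inl j) =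
      expDensity (etaMinus τ) (varrho τ σ r (Sum.inl j)) u := by
  rw [extendedEnsemble_phi hτ hσ, rowScale, expDensity, div_div_eq_mul_div, div_mul_eq_mul_div,
    mul_comm]

theorem extendedEnsemble_DS (hM : Even (N + n)) (hτ : τ ∈ Ioo (0 : ℝ) 1) (hσ : ∀ j, τ < σ j)
    (hr : ∀ a, r a ∈ Ioo (0 : ℝ) (1 / 2)) (hinj : Function.Injective (varrho τ σ r)) (u v : ℝ) :
    (extendedEnsemble τ σ r).DS halfLine u v = ∑ j : Fin N, ∑ k : Fin N,
      expDensity (etaMinus τ) (varrho τ σ r (Sum.inl j)) u *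
        kernelCoeff (varrho τ σ r) (Sum.inl j) (Sum.inl k) *
          expDensity (etaMinus τ) (varrho τ σ r (Sum.inl k)) v := by
  refine Finset.sum_congr rfl fun j _ => Finset.sum_congr rfl fun k _ => ?_
  rw [gram_inv_apply hM hτ hσ hr hinj, ← phi_div_rowScale hτ hσ, ← phi_div_rowScale hτ hσ]
  ring

/-- The scalings in G⁻¹ cancel those in εφ_k and normalise φ_j to `expDensity`, so the powers η^a of
the auxiliary functions disappear. -/
theorem extendedEnsemble_S (hM : Even (N + n)) (hτ : τ ∈ Ioo (0 : ℝ) 1) (hσ : ∀ j, τ < σ j)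
    (hr : ∀ a, r a ∈ Ioo (0 : ℝ) (1 / 2)) (hinj : Function.Injective (varrho τ σ r)) (u : ℝ)
    {v : ℝ} (hv : 0 < v) :
    (extendedEnsemble τ σ r).S halfLine u v = ∑ j : Fin N, ∑ k : Fin N ⊕ Fin n,
      expDensity (etaMinus τ) (varrho τ σ r (Sum.inl j)) u *
        kernelCoeff (varrho τ σ r) (Sum.inl j) k *
          schurForm (besselFun (etaMinus τ * v)) (gaussFun (varrho τ σ r k)) := by
  refine Finset.sum_congr rfl fun j _ => ?_
  rw [Finset.mul_sum]
  refine Finset.sum_congr rfl fun k _ => ?_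
  have hd := rowScale_ne_zero (etaMinus_pos hτ) (varrho_mem hτ hσ hr) k
  rw [gram_inv_apply hM hτ hσ hr hinj, ← phi_div_rowScale hτ hσ,
    extendedEnsemble_epsPhi hτ hσ hr k hv]
  field_simp

theorem extendedEnsemble_IS (hM : Even (N + n)) (hτ : τ ∈ Ioo (0 : ℝ) 1) (hσ : ∀ j, τ < σ j)
    (hr : ∀ a, r a ∈ Ioo (0 : ℝ) (1 / 2)) (hinj : Function.Injective (varrho τ σ r)) {u v : ℝ}
    (hu : 0 < u) (hv : 0 < v) :
    (extendedEnsemble τ σ r).IS halfLine u v = -calE (etaMinus τ * u) (etaMinus τ * v) +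
      ∑ j : Fin N ⊕ Fin n, ∑ k : Fin N ⊕ Fin n,
        schurForm (besselFun (etaMinus τ * u)) (gaussFun (varrho τ σ r j)) *
          kernelCoeff (varrho τ σ r) j k *
            schurForm (besselFun (etaMinus τ * v)) (gaussFun (varrho τ σ r k)) := by
  rw [EnsembleData.IS]
  congr 1
  refine Finset.sum_congr rfl fun j _ => Finset.sum_congr rfl fun k _ => ?_
  have hd := rowScale_ne_zero (etaMinus_pos hτ) (varrho_mem hτ hσ hr)
  have h1 := hd j
  have h2 := hd k
  rw [gram_inv_apply hM hτ hσ hr hinj, extendedEnsemble_epsPhi hτ hσ hr k hv,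
    extendedEnsemble_epsPhi hτ hσ hr j hu]
  field_simp

end Ensemble

/-- This holds for every ρ in (0, 1/2), so the terms k > N, which have no φ_k behind them, are also
produced by integrating exponentials against 𝓔. -/
theorem integral_calE_mul_expDensity {η ρ v : ℝ} (hη : 0 < η) (hρ : ρ ∈ Ioo (0 : ℝ) (1 / 2))
    (hv : 0 < v) :
    Integrable (fun t => ((calE (η * v) (η * t) : ℂ) * (expDensity η ρ t : ℂ))) halfLine ∧
      ∫ t, (calE (η * v) (η * t) : ℂ) * (expDensity η ρ t : ℂ) ∂halfLine =
        (schurForm (besselFun (η * v)) (gaussFun ρ) : ℝ) := by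
  have h := (gaussGrowth_besselFun (mul_pos hη hv).le).integral_exp_mul_schurForm (by norm_num)
    (measurable_besselFun _) hη hρ
  have heq : ∀ᵐ t ∂halfLine, ((η / ρ * (Real.exp (-(η / ρ) * t) *
      schurForm (besselFun (η * v)) (besselFun (η * t))) : ℝ) : ℂ) =
      (calE (η * v) (η * t) : ℂ) * (expDensity η ρ t : ℂ) := by
    filter_upwards [ae_restrict_mem measurableSet_Ioi] with t ht
    rw [calE_eq (mul_pos hη hv).le (mul_pos hη ht).le, expDensity]
    push_cast
    ring
  refine ⟨(h.1.const_mul (η / ρ)).ofReal.congr heq, (integral_congr_ae heq).symm.trans ?_⟩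
  rw [integral_complex_ofReal, integral_const_mul, h.2, ← mul_assoc,
    div_mul_div_cancel₀ hρ.1.ne', div_self hη.ne', one_mul]

/-! ### The contour kernels integrated against 𝓔. -/

section KernelIntegrals

variable {ι : Type*} [Fintype ι] [DecidableEq ι] [Nonempty ι] {ϱ : ι → ℝ} {A : Set ι}
  {Γw Γz : Contour} {η : ℝ}

theorem contourKernel_eq (hinj : Function.Injective ϱ) (hϱ : ∀ k, ϱ k ∈ Ioo (0 : ℝ) (1 / 2))
    {B : Set ι} (hw : IsWContour ϱ A Γw) (hz : IsZContour ϱ B Γz) (η u v : ℝ) :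
    contourKernel η ϱ Γw Γz u v = ∑ j, ∑ k, A.indicator 1 j * B.indicator 1 k *
      ((expDensity η (ϱ j) u : ℂ) * kernelCoeff ϱ j k * expDensity η (ϱ k) v) := by
  rw [contourKernel_eq_sum hinj hϱ hw hz]
  simp_rw [residueCoeff_eq hϱ]
  rfl

theorem integral_calE_mul_contourKernel (hinj : Function.Injective ϱ)
    (hϱ : ∀ k, ϱ k ∈ Ioo (0 : ℝ) (1 / 2)) (hw : IsWContour ϱ A Γw) (hz : IsZContour ϱ univ Γz)
    (hη : 0 < η) (u : ℝ) {v : ℝ} (hv : 0 < v) :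
    Integrable (fun t => (calE (η * v) (η * t) : ℂ) * contourKernel η ϱ Γw Γz u t) halfLine ∧
      ∫ t, (calE (η * v) (η * t) : ℂ) * contourKernel η ϱ Γw Γz u t ∂halfLine =
        ∑ j, ∑ k, A.indicator 1 j * ((expDensity η (ϱ j) u : ℂ) * kernelCoeff ϱ j k *
          schurForm (besselFun (η * v)) (gaussFun (ϱ k))) := by
  have heq : ∀ t, (calE (η * v) (η * t) : ℂ) * contourKernel η ϱ Γw Γz u t =
      ∑ j, ∑ k, A.indicator 1 j * ((expDensity η (ϱ j) u : ℂ) * kernelCoeff ϱ j k) *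
        ((calE (η * v) (η * t) : ℂ) * (expDensity η (ϱ k) t : ℂ)) := by
    intro t
    rw [contourKernel_eq hinj hϱ hw hz, Finset.mul_sum]
    refine Finset.sum_congr rfl fun j _ => ?_
    rw [Finset.mul_sum]
    refine Finset.sum_congr rfl fun k _ => ?_
    rw [indicator_univ, Pi.one_apply]
    ring
  have hint := fun k => integral_calE_mul_expDensity hη (hϱ k) hv
  have h1 : ∀ j k, Integrable (fun t => A.indicator 1 j * ((expDensity η (ϱ j) u : ℂ) *
      kernelCoeff ϱ j k) * ((calE (η * v) (η * t) : ℂ) * (expDensity η (ϱ k) t : ℂ))) halfLine :=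
    fun j k => (hint k).1.const_mul _
  simp_rw [heq]
  refine ⟨integrable_finsetSum _ fun j _ => integrable_finsetSum _ fun k _ => h1 j k, ?_⟩
  rw [integral_finsetSum _ fun j _ => integrable_finsetSum _ fun k _ => h1 j k]
  refine Finset.sum_congr rfl fun j _ => ?_
  rw [integral_finsetSum _ fun k _ => h1 j k]
  refine Finset.sum_congr rfl fun k _ => ?_
  rw [integral_const_mul, (hint k).2]
  ring

theorem integral_calE_mul_contourKernel_mul_calE (hinj : Function.Injective ϱ)
    (hϱ : ∀ k, ϱ k ∈ Ioo (0 : ℝ) (1 / 2)) (hw : IsWContour ϱ univ Γw) (hz : IsZContour ϱ univ Γz)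
    (hη : 0 < η) {u v : ℝ} (hu : 0 < u) (hv : 0 < v) :
    Integrable (fun p : ℝ × ℝ => (calE (η * v) (η * p.2) : ℂ) *
      contourKernel η ϱ Γw Γz p.1 p.2 * (calE (η * u) (η * p.1) : ℂ)) (halfLine.prod halfLine) ∧
      ∫ p : ℝ × ℝ, (calE (η * v) (η * p.2) : ℂ) * contourKernel η ϱ Γw Γz p.1 p.2 *
        (calE (η * u) (η * p.1) : ℂ) ∂(halfLine.prod halfLine) =
        ∑ j, ∑ k, ((schurForm (besselFun (η * u)) (gaussFun (ϱ j)) : ℂ) * kernelCoeff ϱ j k *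
          schurForm (besselFun (η * v)) (gaussFun (ϱ k))) := by
  have heq : ∀ p : ℝ × ℝ, (calE (η * v) (η * p.2) : ℂ) * contourKernel η ϱ Γw Γz p.1 p.2 *
      (calE (η * u) (η * p.1) : ℂ) = ∑ j, ∑ k, (kernelCoeff ϱ j k : ℂ) *
        (((calE (η * u) (η * p.1) : ℂ) * (expDensity η (ϱ j) p.1 : ℂ)) *
          ((calE (η * v) (η * p.2) : ℂ) * (expDensity η (ϱ k) p.2 : ℂ))) := by
    intro p
    rw [contourKernel_eq hinj hϱ hw hz, Finset.mul_sum, Finset.sum_mul]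
    refine Finset.sum_congr rfl fun j _ => ?_
    rw [Finset.mul_sum, Finset.sum_mul]
    refine Finset.sum_congr rfl fun k _ => ?_
    rw [indicator_univ, Pi.one_apply, Pi.one_apply]
    ring
  have hintu := fun k => integral_calE_mul_expDensity hη (hϱ k) hu
  have hintv := fun k => integral_calE_mul_expDensity hη (hϱ k) hv
  have h1 : ∀ j k, Integrable (fun p : ℝ × ℝ => (kernelCoeff ϱ j k : ℂ) *
      (((calE (η * u) (η * p.1) : ℂ) * (expDensity η (ϱ j) p.1 : ℂ)) *
        ((calE (η * v) (η * p.2) : ℂ) * (expDensity η (ϱ k) p.2 : ℂ)))) (halfLine.prod halfLine) :=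
    fun j k => ((hintu j).1.mul_prod (hintv k).1).const_mul _
  simp_rw [heq]
  refine ⟨integrable_finsetSum _ fun j _ => integrable_finsetSum _ fun k _ => h1 j k, ?_⟩
  rw [integral_finsetSum _ fun j _ => integrable_finsetSum _ fun k _ => h1 j k]
  refine Finset.sum_congr rfl fun j _ => ?_
  rw [integral_finsetSum _ fun k _ => h1 j k]
  refine Finset.sum_congr rfl fun k _ => ?_
  rw [integral_const_mul, integral_prod_mul (fun s => (calE (η * u) (η * s) : ℂ) *
    (expDensity η (ϱ j) s : ℂ)) (fun t => (calE (η * v) (η * t) : ℂ) *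
    (expDensity η (ϱ k) t : ℂ)), (hintu j).2, (hintv k).2]
  ring

end KernelIntegrals

end PfaffianKernel

theorem mainTheorem8 (N n : ℕ) (hN : 0 < N) (hM : Even (N + n))
    (τ : ℝ) (hτ : τ ∈ Set.Ioo (0 : ℝ) 1) (σ : Fin N → ℝ) (hσ : ∀ j, τ < σ j)
    (r : Fin n → ℝ) (hr : ∀ a, r a ∈ Set.Ioo (0 : ℝ) (1 / 2))
    (η : ℝ) (hη : η = etaMinus τ)
    (ϱ : Fin N ⊕ Fin n → ℝ) (hϱ : ϱ = varrho τ σ r)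
    (hinj : Function.Injective ϱ)
    (D : EnsembleData ℝ N n) (hD : D = extendedEnsemble τ σ r) :
    -- all integrals entering the definition of the ensemble and of its Gram matrix converge
    ((∀ u v : ℝ, 0 < u → 0 < v →
        MeasureTheory.Integrable (calEIntegrand (η * u) (η * v))) ∧
      (∀ (a : Fin n) (u : ℝ), 0 < u → MeasureTheory.Integrable (hIntegrand η (r a) u)) ∧
      (∀ a b : Fin n, MeasureTheory.Integrable (alphaIntegrand (r a) (r b))) ∧
      (∀ (k : Fin N) (u : ℝ), 0 < u →
        MeasureTheory.Integrable (fun t => D.eps u t * D.phi k t) halfLine) ∧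
      (∀ (j : Fin N) (k : Fin N ⊕ Fin n),
        MeasureTheory.Integrable (fun t => D.phi j t * D.epsPhi halfLine k t) halfLine)) ∧
    -- the Gram matrix is invertible
    IsUnit (D.gram halfLine) ∧
    -- the formula for `DS_N`
    (∀ Γw Γz : Contour, IsWContour ϱ (Set.range Sum.inl) Γw →
      IsZContour ϱ (Set.range Sum.inl) Γz → ∀ u v : ℝ, 0 < u → 0 < v →
        (D.DS halfLine u v : ℂ) = contourKernel η ϱ Γw Γz u v) ∧
    -- the formula for `S_N`
    (∀ Γw Γz : Contour, IsWContour ϱ (Set.range Sum.inl) Γw →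
      IsZContour ϱ Set.univ Γz → ∀ u v : ℝ, 0 < u → 0 < v →
        MeasureTheory.IntegrableOn
          (fun t : ℝ => (calE (η * v) (η * t) : ℂ) * contourKernel η ϱ Γw Γz u t)
          (Set.Ioi 0) ∧
        (D.S halfLine u v : ℂ) =
          ∫ t in Set.Ioi (0 : ℝ), (calE (η * v) (η * t) : ℂ) * contourKernel η ϱ Γw Γz u t) ∧
    -- the formula for `IS_N`
    (∀ Γw Γz : Contour, IsWContour ϱ Set.univ Γw →
      IsZContour ϱ Set.univ Γz → ∀ u v : ℝ, 0 < u → 0 < v →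
        MeasureTheory.IntegrableOn
          (fun p : ℝ × ℝ => (calE (η * v) (η * p.2) : ℂ) *
            contourKernel η ϱ Γw Γz p.1 p.2 * (calE (η * u) (η * p.1) : ℂ))
          (Set.Ioi 0 ×ˢ Set.Ioi 0) ∧
        (D.IS halfLine u v : ℂ) = -(calE (η * u) (η * v) : ℂ) +
          ∫ p in Set.Ioi (0 : ℝ) ×ˢ Set.Ioi (0 : ℝ), (calE (η * v) (η * p.2) : ℂ) *
            contourKernel η ϱ Γw Γz p.1 p.2 * (calE (η * u) (η * p.1) : ℂ)) := by
  subst hη hϱ hD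
  have hmem := varrho_mem hτ hσ hr
  have hη0 := etaMinus_pos hτ
  -- The partial fraction step inside the residue evaluation needs at least one pole, which N ≥ 1
  -- provides.
  have : Nonempty (Fin N ⊕ Fin n) := ⟨Sum.inl ⟨0, hN⟩⟩
  refine ⟨⟨fun u v hu hv => integrable_calEIntegrand (mul_pos hη0 hu).le (mul_pos hη0 hv).le,
    fun a u hu => integrable_hIntegrand (mul_pos hη0 hu).le (hr a),
    fun a b => integrable_alphaIntegrand (hr a) (hr b),
    fun k u hu => (integrable_eps_mul_phi hτ hσ hr k hu).1,
    fun j k => (integral_phi_mul_epsPhi hτ hσ hr j k).1⟩,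
    IsUnit.of_mul_eq_one _ (gram_mul_eq_one hM hτ hσ hr hinj),
    fun Γw Γz hw hz u v _ _ => ?_, fun Γw Γz hw hz u v _ hv => ?_, fun Γw Γz hw hz u v hu hv => ?_⟩
  · rw [extendedEnsemble_DS hM hτ hσ hr hinj, contourKernel_eq hinj hmem hw hz]
    -- The indicator of `Set.range Sum.inl` is 1 on the first N indices and 0 on the auxiliary ones,
    -- which truncates both sums.
    simp
  · have h := integral_calE_mul_contourKernel hinj hmem hw hz hη0 u hv
    refine ⟨h.1, Eq.trans ?_ h.2.symm⟩
    rw [extendedEnsemble_S hM hτ hσ hr hinj u hv]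
    simp
  · have h := integral_calE_mul_contourKernel_mul_calE hinj hmem hw hz hη0 hu hv
    rw [halfLine, MeasureTheory.Measure.prod_restrict,
      ← MeasureTheory.Measure.volume_eq_prod] at h
    refine ⟨h.1, ?_⟩
    rw [h.2, extendedEnsemble_IS hM hτ hσ hr hinj hu hv]
    push_cast
    rfl
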